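/- Let $n\ge 1$, $s\in(\tfrac12,1)$, $0<\lambda\le\Lambda$ and $m>1$. Put $\omega_s(z)=(1+|z|)^{-n-2s}$, and write $C^{1,1}(x)$ for the functions $u:\mathbb R^n\to\mathbb R$ for which there are $p\in\mathbb R^n$ and $C,\eta>0$ with $|u(x+z)-u(x)-p\cdot z|\le C|z|^2$ for $|z|<\eta$. Let $\mathcal K_{\rm sym}$ be the set of measurable nonnegative kernels $K$ on $\mathbb R^n\setminus\{0\}$ with $K(z)=K(-z)$ and $\lambda|z|^{-n-2s}\le K(z)\le\Lambda|z|^{-n-2s}$ for all $z\ne0$, and set $$L_Ku(x)=\int_{\mathbb R^n}\bigl[u(x+z)-u(x)-1_{\{|z|<1\}}\nabla u(x)\cdot z\bigr]K(z)\,dz .$$ Let $\mathcal I_{\rm sym}$ be an operator, assigning a real number $\mathcal I_{\rm sym}u(x)$ to every $x\in\mathbb R^n$ and $u\in C^{1,1}(x)\cap L^1(\omega_s)$, which is translation invariant ($\mathcal I_{\rm sym}[u(\cdot+h)](x)=\mathcal I_{\rm sym}u(x+h)$), positively $1$-homogeneous ($\mathcal I_{\rm sym}[cu]=c\,\mathcal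 I_{\rm sym}u$ for $c>0$), and elliptic with respect to $\mathcal K_{\rm sym}$: $$\inf_{K\in\mathcal K_{\rm sym}}(L_Ku(x)-L_Kv(x))\le\mathcal I_{\rm sym}u(x)-\mathcal I_{\rm sym}v(x)\le\sup_{K\in\mathcal K_{\rm sym}}(L_Ku(x)-L_Kv(x))$$ for all $u,v\in C^{1,1}(x)\cap L^1(\omega_s)$. Let $u:\mathbb R^n\to\mathbb R$ be a non-trivial (not identically zero) viscosity solution of $$-\mathcal I_{\rm sym}u+|\nabla u|^m=0\quad\text{in }\mathbb R^n .$$ This means that $u$ is continuous, $u\in L^1(\omega_s)$, and the following holds whenever $x_0\in\mathbb R^n$, $r>0$, $\varphi\in C^2(B_r(x_0))$, $u(x_0)=\varphi(x_0)$, and the function $v$ equal to $\varphi$ in $B_r(x_0)$ and to $u$ elsewhere belongs to $L^1(\omega_s)$: if $u\le\varphi$ in $B_r(x_0)$, then $-\mathcal I_{\rm sym}v(x_0)+|\nabla\varphi(x_0)|^m\le0$; if $u\ge\varphi$ in $B_r(x_0)$, then $-\mathcal I_{\rm sym}v(x_0)+|\nabla\varphi(x_0)|^m\ge0$. Suppose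 that for some $M\in\mathbb R$ and some real $\gamma<2s$ $$|u(x)|\le M(1+|x|)^\gamma\quad\text{for all }x\in\mathbb R^n,\qquad \limsup_{|x|\to\infty}\frac{|u(x)|}{|x|^\gamma}>0 .$$ Then $\gamma\le\max\bigl\{0,\frac{m-2s}{m-1}\bigr\}$. -/

import Mathlib

noncomputable section

namespace NonlocalHJ

/-- Membership in the weighted space `L^1(ω_s)`, where `ω_s(z) = (1 + |z|)^(-n-2s)`. -/
def InWeightedL1 {n : ℕ} (s : ℝ) (u : EuclideanSpace ℝ (Fin n) → ℝ) : Prop :=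
  MeasureTheory.Integrable
    (fun z : EuclideanSpace ℝ (Fin n) => u z * (1 + ‖z‖) ^ (-((n : ℝ) + 2 * s)))
    MeasureTheory.volume

/-- Pointwise `C^{1,1}` regularity at `x`: up to an error `C |z|^2`, the function `u` is affine
near `x`.  (The slope `p` is then the gradient of `u` at `x`.) -/
def IsC11At {n : ℕ} (u : EuclideanSpace ℝ (Fin n) → ℝ) (x : EuclideanSpace ℝ (Fin n)) : Prop :=
  ∃ (p : EuclideanSpace ℝ (Fin n)) (C η : ℝ), 0 < η ∧
    ∀ z : EuclideanSpace ℝ (Fin n), ‖z‖ < η → |u (x + z) - u x - inner ℝ p z| ≤ C * ‖z‖ ^ 2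

/-- `u ∈ C^{1,1}(x) ∩ L^1(ω_s)`: the functions on which the operators are evaluated at `x`. -/
def Admissible {n : ℕ} (s : ℝ) (u : EuclideanSpace ℝ (Fin n) → ℝ)
    (x : EuclideanSpace ℝ (Fin n)) : Prop :=
  IsC11At u x ∧ InWeightedL1 s u

/-- The class `K_sym(lam, Lam)` of symmetric measurable nonnegative kernels comparable with
`|z|^(-n-2s)` away from the origin.  The value of a kernel at the origin plays no role. -/
def symKernels (n : ℕ) (s lam Lam : ℝ) : Set (EuclideanSpace ℝ (Fin n) → ℝ) :=
  {K | Measurable K ∧ ∀ z : EuclideanSpace ℝ (Fin n), z ≠ 0 →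
    0 ≤ K z ∧ lam / ‖z‖ ^ ((n : ℝ) + 2 * s) ≤ K z ∧ K z ≤ Lam / ‖z‖ ^ ((n : ℝ) + 2 * s) ∧
      K (-z) = K z}

/-- The linear operator `L_K`, with the drift correction in the unit ball when `2s ∈ [1, 2)`. -/
def linOp {n : ℕ} (s : ℝ) (K u : EuclideanSpace ℝ (Fin n) → ℝ)
    (x : EuclideanSpace ℝ (Fin n)) : ℝ :=
  ∫ z : EuclideanSpace ℝ (Fin n),
    (u (x + z) - u x -
      (if (1 ≤ 2 * s ∧ 2 * s < 2) ∧ ‖z‖ < 1 then inner ℝ (gradient u x) z else 0)) * K z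

/-- Translation invariant, positively `1`-homogeneous nonlocal operators of order `2s`, elliptic
with respect to `K_sym(lam, Lam)`.  `I u x` is the value at `x` of the operator applied to `u`; it
is meaningful, and constrained, only when `u` is admissible at `x`. -/
structure IsSymEllipticOperator {n : ℕ} (s lam Lam : ℝ)
    (I : (EuclideanSpace ℝ (Fin n) → ℝ) → EuclideanSpace ℝ (Fin n) → ℝ) : Prop where
  translation : ∀ (u : EuclideanSpace ℝ (Fin n) → ℝ) (x h : EuclideanSpace ℝ (Fin n)),
    Admissible s u (x + h) → I (fun y => u (y + h)) x = I u (x + h)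
  homogeneous : ∀ (u : EuclideanSpace ℝ (Fin n) → ℝ) (x : EuclideanSpace ℝ (Fin n)) (c : ℝ),
    0 < c → Admissible s u x → I (fun y => c * u y) x = c * I u x
  elliptic_lower : ∀ (u v : EuclideanSpace ℝ (Fin n) → ℝ) (x : EuclideanSpace ℝ (Fin n)),
    Admissible s u x → Admissible s v x →
      (⨅ K : symKernels n s lam Lam, (linOp s K.1 u x - linOp s K.1 v x)) ≤ I u x - I v x
  elliptic_upper : ∀ (u v : EuclideanSpace ℝ (Fin n) → ℝ) (x : EuclideanSpace ℝ (Fin n)),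
    Admissible s u x → Admissible s v x →
      I u x - I v x ≤ ⨆ K : symKernels n s lam Lam, (linOp s K.1 u x - linOp s K.1 v x)

open Classical in
/-- The function equal to `φ` in the ball `B_r(x₀)` and to `u` elsewhere. -/
def glue {n : ℕ} (u φ : EuclideanSpace ℝ (Fin n) → ℝ) (x₀ : EuclideanSpace ℝ (Fin n)) (r : ℝ) :
    EuclideanSpace ℝ (Fin n) → ℝ :=
  fun y => if y ∈ Metric.ball x₀ r then φ y else u y

/-- Viscosity subsolutions of `-I u + H(∇u) = 0` in the whole space.  The condition that
`glue u φ x₀ r` is in `L^1(ω_s)` only makes sure that `I` can be evaluated on it (a `C^2` function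
on an open ball may blow up at the boundary). -/
structure IsViscositySubsolution {n : ℕ} (s : ℝ)
    (I : (EuclideanSpace ℝ (Fin n) → ℝ) → EuclideanSpace ℝ (Fin n) → ℝ)
    (H : EuclideanSpace ℝ (Fin n) → ℝ) (u : EuclideanSpace ℝ (Fin n) → ℝ) : Prop where
  measurable : Measurable u
  weighted : InWeightedL1 s u
  semicontinuous : UpperSemicontinuous u
  test : ∀ (x₀ : EuclideanSpace ℝ (Fin n)) (r : ℝ) (φ : EuclideanSpace ℝ (Fin n) → ℝ),
    0 < r → ContDiffOn ℝ 2 φ (Metric.ball x₀ r) → InWeightedL1 s (glue u φ x₀ r) →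
    u x₀ = φ x₀ → (∀ y ∈ Metric.ball x₀ r, u y ≤ φ y) →
      -I (glue u φ x₀ r) x₀ + H (gradient φ x₀) ≤ 0

/-- Viscosity supersolutions of `-I u + H(∇u) = 0` in the whole space. -/
structure IsViscositySupersolution {n : ℕ} (s : ℝ)
    (I : (EuclideanSpace ℝ (Fin n) → ℝ) → EuclideanSpace ℝ (Fin n) → ℝ)
    (H : EuclideanSpace ℝ (Fin n) → ℝ) (u : EuclideanSpace ℝ (Fin n) → ℝ) : Prop where
  measurable : Measurable u
  weighted : InWeightedL1 s u
  semicontinuous : LowerSemicontinuous u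
  test : ∀ (x₀ : EuclideanSpace ℝ (Fin n)) (r : ℝ) (φ : EuclideanSpace ℝ (Fin n) → ℝ),
    0 < r → ContDiffOn ℝ 2 φ (Metric.ball x₀ r) → InWeightedL1 s (glue u φ x₀ r) →
    u x₀ = φ x₀ → (∀ y ∈ Metric.ball x₀ r, φ y ≤ u y) →
      0 ≤ -I (glue u φ x₀ r) x₀ + H (gradient φ x₀)

/-- Viscosity solutions of `-I u + H(∇u) = 0` in the whole space. -/
def IsViscositySolution {n : ℕ} (s : ℝ)
    (I : (EuclideanSpace ℝ (Fin n) → ℝ) → EuclideanSpace ℝ (Fin n) → ℝ)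
    (H : EuclideanSpace ℝ (Fin n) → ℝ) (u : EuclideanSpace ℝ (Fin n) → ℝ) : Prop :=
  IsViscositySubsolution s I H u ∧ IsViscositySupersolution s I H u

end NonlocalHJ

end

/-! Suppose `γ > 0` and `γ (m - 1) > m - 2s`. On balls of radius `R` the function has size `R^γ`, so
the nonlocal term has order `R^(γ-2s)` and the gradient term order `R^(m(γ-1))`. The assumption says
exactly that `γ - 2s < m (γ - 1)`: the gradient term wins at large scales, so the rescalings `R^(-γ)
u(R ·)` should flatten to constants. The proof makes this quantitative by showing that the
oscillation of `u` on `B_R` is at most `ε R^γ` for large `R`. Comparison with `u 0` then gives `|u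
x| / ‖x‖^γ → 0`, against the positive limsup.

Two estimates carry this.

A modulus of continuity uniform in `R` (`exists_cone_bound`, `exists_modulus`) comes from doubling
variables in `(1 - κ) u(x) - u(y)` minus a cone in `x - y`. Since `m > 1`, the factor `1 - κ` makes
the two gradient terms differ by a positive multiple of `‖p‖^m`, `p` being the slope of the cone.
For a steep cone this exceeds the localisation error, even at the critical exponent.

Flattening (`exists_oscillation_le`) comes from touching `u` from above by a small multiple of a
smooth weight centred at `y` with width `R`. The subsolution inequality bounds the gradient of the
weight at the contact point, which forces that point close to `y`; the modulus then compares its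
value with `u y`.

The weight grows like `‖x‖^σ` with `max 1 γ < σ < 2s`: `σ > γ` makes it dominate `u`, `σ < 2s` makes
its increments integrable against the kernels, and `σ > 1` lets linear terms be absorbed at
infinity. -/

noncomputable section

namespace NonlocalHJ

open MeasureTheory Set Metric Filter Topology

/-! ### The modulus of second order increments -/

/-- The modulus `min (t², t^σ)`, controlling second order increments at all scales. -/
def powMin (σ t : ℝ) : ℝ := min (t ^ 2) (t ^ σ)

lemma powMin_nonneg {σ t : ℝ} (ht : 0 ≤ t) : 0 ≤ powMin σ t :=
  le_min (by positivity) (by positivity)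

lemma powMin_of_le_one {σ t : ℝ} (hσ : σ ≤ 2) (ht : 0 ≤ t) (ht1 : t ≤ 1) :
    powMin σ t = t ^ 2 := by
  rcases ht.eq_or_lt with rfl | h
  · rw [powMin, min_eq_left]
    rw [zero_pow two_ne_zero]
    positivity
  · rw [powMin, min_eq_left]
    rw [← Real.rpow_natCast t 2]
    exact Real.rpow_le_rpow_of_exponent_ge h ht1 (by exact_mod_cast hσ)

lemma powMin_of_one_le {σ t : ℝ} (hσ : σ ≤ 2) (ht1 : 1 ≤ t) : powMin σ t = t ^ σ := by
  rw [powMin, min_eq_right]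
  rw [← Real.rpow_natCast t 2]
  exact Real.rpow_le_rpow_of_exponent_le ht1 (by exact_mod_cast hσ)

/-- This is where `σ ≥ 1` enters: away from the origin the modulus absorbs constants and linear
terms. -/
lemma mul_le_powMin {σ t η : ℝ} (hσ : 1 ≤ σ) (hσ2 : σ ≤ 2) (hη : 0 < η) (hη1 : η ≤ 1)
    (ht : η ≤ t) : η * t ≤ powMin σ t := by
  have ht0 : 0 < t := hη.trans_le ht
  rcases le_total t 1 with h | h
  · rw [powMin_of_le_one hσ2 ht0.le h]
    nlinarith
  · rw [powMin_of_one_le hσ2 h]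
    have : t ≤ t ^ σ := by
      simpa using Real.rpow_le_rpow_of_exponent_le h hσ
    nlinarith

/-! ### Integrability against the kernels and two-point comparison -/

section

variable {n : ℕ} {s σ : ℝ}

/-- In polar coordinates the integrand is `t^(1-2s)` near zero, integrable since `s < 1`, and
`t^(σ-1-2s)` near infinity, integrable since `σ < 2s`. -/
lemma integrable_powMin_mul_rpow (hn : 1 ≤ n) (hσ : σ < 2 * s) (hs1 : s < 1) :
    Integrable (fun z : EuclideanSpace ℝ (Fin n) =>
      powMin σ ‖z‖ * ‖z‖ ^ (-((n : ℝ) + 2 * s))) := by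
  have : Nontrivial (EuclideanSpace ℝ (Fin n)) := by
    apply Module.nontrivial_of_finrank_pos (R := ℝ)
    rw [finrank_euclideanSpace, Fintype.card_fin]
    omega
  rw [integrable_fun_norm_addHaar volume
    (f := fun t : ℝ => powMin σ t * t ^ (-((n : ℝ) + 2 * s)))]
  simp only [finrank_euclideanSpace, Fintype.card_fin, smul_eq_mul]
  have key : ∀ (t b : ℝ), 0 < t →
      t ^ (n - 1) * (t ^ b * t ^ (-((n : ℝ) + 2 * s))) = t ^ (b - 1 - 2 * s) := by
    intro t b ht
    rw [← Real.rpow_natCast t (n - 1), ← Real.rpow_add ht, ← Real.rpow_add ht]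
    congr 1
    rw [Nat.cast_sub hn]
    push_cast
    ring
  rw [← Ioc_union_Ioi_eq_Ioi zero_le_one]
  refine IntegrableOn.union ?_ ?_
  · have h1 : IntegrableOn (fun t : ℝ => t ^ (2 - 1 - 2 * s)) (Ioc 0 1) := by
      rw [integrableOn_Ioc_iff_integrableOn_Ioo,
        intervalIntegral.integrableOn_Ioo_rpow_iff zero_lt_one]
      linarith
    refine h1.congr_fun ?_ measurableSet_Ioc
    intro t ht
    simp only
    rw [powMin_of_le_one (by linarith) ht.1.le ht.2, ← Real.rpow_natCast t 2]
    exact (key t 2 ht.1).symm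
  · have h1 : IntegrableOn (fun t : ℝ => t ^ (σ - 1 - 2 * s)) (Ioi 1) :=
      integrableOn_Ioi_rpow_of_lt (by linarith) zero_lt_one
    refine h1.congr_fun ?_ measurableSet_Ioi
    intro t ht
    simp only
    rw [powMin_of_one_le (by linarith) (le_of_lt ht)]
    exact (key t σ (zero_lt_one.trans ht)).symm

/-- `u` is affine with slope `p` near `x` up to a quadratic error. -/
def HasC11Slope (u : EuclideanSpace ℝ (Fin n) → ℝ) (x p : EuclideanSpace ℝ (Fin n)) : Prop :=
  ∃ C η : ℝ, 0 < η ∧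
    ∀ z : EuclideanSpace ℝ (Fin n), ‖z‖ < η → |u (x + z) - u x - inner ℝ p z| ≤ C * ‖z‖ ^ 2

lemma HasC11Slope.hasGradientAt {u : EuclideanSpace ℝ (Fin n) → ℝ}
    {x p : EuclideanSpace ℝ (Fin n)} (h : HasC11Slope u x p) : HasGradientAt u p x := by
  obtain ⟨C, η, hη, h⟩ := h
  rw [hasGradientAt_iff_isLittleO_nhds_zero]
  have h2 : (fun z : EuclideanSpace ℝ (Fin n) => ‖z‖ ^ 2) =o[𝓝 0] fun z => z := by
    simpa using (Asymptotics.isLittleO_norm_pow_id (E' := EuclideanSpace ℝ (Fin n)) one_lt_two)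
  refine Asymptotics.IsBigO.trans_isLittleO ?_ h2
  refine Asymptotics.IsBigO.of_bound C ?_
  filter_upwards [ball_mem_nhds (0 : EuclideanSpace ℝ (Fin n)) hη] with z hz
  rw [mem_ball_zero_iff] at hz
  simpa using h z hz

lemma one_add_norm_rpow_pos (a : ℝ) (x : EuclideanSpace ℝ (Fin n)) : 0 < (1 + ‖x‖) ^ a := by
  positivity

lemma InWeightedL1.integrable_translate {u : EuclideanSpace ℝ (Fin n) → ℝ}
    (hu : InWeightedL1 s u) (x : EuclideanSpace ℝ (Fin n)) :
    Integrable (fun z => u (x + z) * (1 + ‖x + z‖) ^ (-((n : ℝ) + 2 * s))) :=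
  Integrable.comp_add_left hu x

lemma aestronglyMeasurable_of_mul_weight {α : Type*} [MeasurableSpace α] {μ : Measure α}
    {f w : α → ℝ} (h : AEStronglyMeasurable (fun x => f x * w x) μ) (hw : Measurable w)
    (h0 : ∀ x, w x ≠ 0) : AEStronglyMeasurable f μ := by
  refine (h.mul hw.inv.aestronglyMeasurable).congr (Eventually.of_forall fun x => ?_)
  simp [h0 x]

lemma InWeightedL1.aestronglyMeasurable_translate {u : EuclideanSpace ℝ (Fin n) → ℝ}
    (hu : InWeightedL1 s u) (x : EuclideanSpace ℝ (Fin n)) :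
    AEStronglyMeasurable (fun z => u (x + z)) volume :=
  aestronglyMeasurable_of_mul_weight (hu.integrable_translate x).1 (by fun_prop)
    fun z => (one_add_norm_rpow_pos _ (x + z)).ne'

lemma symKernels_le {lam Lam : ℝ} {K : EuclideanSpace ℝ (Fin n) → ℝ}
    (hK : K ∈ symKernels n s lam Lam) {z : EuclideanSpace ℝ (Fin n)} (hz : z ≠ 0) :
    K z ≤ Lam * ‖z‖ ^ (-((n : ℝ) + 2 * s)) := by
  have := (hK.2 z hz).2.2.1
  rwa [Real.rpow_neg (norm_nonneg _), ← div_eq_mul_inv]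

/-- If `|F z|` is at most a weight times a multiple of the model kernel, then `F K` is integrable. -/
lemma integrable_mul_kernel {lam Lam : ℝ} {K F B : EuclideanSpace ℝ (Fin n) → ℝ}
    (hK : K ∈ symKernels n s lam Lam) (hF : AEStronglyMeasurable F volume) (hF0 : F 0 = 0)
    (hB : Integrable B)
    (h : ∀ z : EuclideanSpace ℝ (Fin n), z ≠ 0 → |F z| * ‖z‖ ^ (-((n : ℝ) + 2 * s)) ≤ B z) :
    Integrable (fun z => F z * K z) := by
  refine (hB.norm.const_mul |Lam|).mono' (hF.mul hK.1.aestronglyMeasurable)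
    (Eventually.of_forall fun z => ?_)
  rcases eq_or_ne z 0 with rfl | hz
  · simp [hF0]
    positivity
  · have h0 := (hK.2 z hz).1
    have h1 := symKernels_le hK hz
    have h2 : 0 ≤ ‖z‖ ^ (-((n : ℝ) + 2 * s)) := by positivity
    rw [Real.norm_eq_abs, abs_mul, abs_of_nonneg h0, Real.norm_eq_abs]
    calc |F z| * K z ≤ |F z| * (|Lam| * ‖z‖ ^ (-((n : ℝ) + 2 * s))) := by
          gcongr
          exact h1.trans (by gcongr; exact le_abs_self _)
      _ = |Lam| * (|F z| * ‖z‖ ^ (-((n : ℝ) + 2 * s))) := by ring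
      _ ≤ |Lam| * |B z| := by
          gcongr
          exact (h z hz).trans (le_abs_self _)

lemma rpow_neg_norm_le_translate {a η : ℝ} (ha : 0 ≤ a) (hη : 0 < η)
    (x z : EuclideanSpace ℝ (Fin n)) (hz : η ≤ ‖z‖) :
    ‖z‖ ^ (-a) ≤ ((1 + ‖x‖) / η + 1) ^ a * (1 + ‖x + z‖) ^ (-a) := by
  have hz0 : 0 < ‖z‖ := hη.trans_le hz
  have h1 : 1 + ‖x + z‖ ≤ ((1 + ‖x‖) / η + 1) * ‖z‖ := by
    have : 1 + ‖x‖ ≤ (1 + ‖x‖) / η * ‖z‖ := by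
      rw [div_mul_eq_mul_div, le_div_iff₀ hη]
      gcongr
    linarith [norm_add_le x z]
  have hp : 0 < 1 + ‖x + z‖ := by positivity
  have h2 := Real.rpow_le_rpow hp.le h1 ha
  rw [Real.mul_rpow (by positivity) hz0.le] at h2
  rw [Real.rpow_neg hz0.le, Real.rpow_neg hp.le, ← div_eq_mul_inv, inv_eq_one_div,
    div_le_div_iff₀ (by positivity) (by positivity), one_mul]
  exact h2

/-- Near the origin the quadratic error suffices. Far away the constant and linear terms fall under
`powMin`, and the translate of `u` is controlled by its weighted integrability. -/
lemma HasC11Slope.integrable_increment {lam Lam : ℝ} (hn : 1 ≤ n) (hσ1 : 1 < σ)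
    (hσ : σ < 2 * s) (hs1 : s < 1)
    {u : EuclideanSpace ℝ (Fin n) → ℝ} {x p : EuclideanSpace ℝ (Fin n)} (h : HasC11Slope u x p)
    (hu : InWeightedL1 s u) {K : EuclideanSpace ℝ (Fin n) → ℝ}
    (hK : K ∈ symKernels n s lam Lam) :
    Integrable (fun z => (u (x + z) - u x - inner ℝ p z) * K z) := by
  obtain ⟨C, η₀, hη₀, h⟩ := h
  obtain ⟨η, hη, hη1, hηη⟩ : ∃ η : ℝ, 0 < η ∧ η ≤ 1 ∧ η ≤ η₀ :=
    ⟨min η₀ 1, lt_min hη₀ one_pos, min_le_right _ _, min_le_left _ _⟩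
  set a : ℝ := (n : ℝ) + 2 * s with ha_def
  have ha : 0 ≤ a := by
    have : (0 : ℝ) ≤ n := n.cast_nonneg
    linarith
  set C₁ : ℝ := |C| + (|u x| / η ^ 2 + ‖p‖ / η)
  set D : ℝ := ((1 + ‖x‖) / η + 1) ^ a
  have hD : 0 ≤ D := by positivity
  have hI := (integrable_powMin_mul_rpow (n := n) hn hσ hs1).const_mul C₁
  have hT := (hu.integrable_translate x).norm.const_mul D
  refine integrable_mul_kernel hK ?_ (by simp) (hI.add hT) ?_
  · exact ((hu.aestronglyMeasurable_translate x).sub aestronglyMeasurable_const).sub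
      (by fun_prop)
  · intro z hz
    have hz0 : 0 < ‖z‖ := norm_pos_iff.2 hz
    have hm := powMin_nonneg (σ := σ) hz0.le
    have hk : 0 ≤ ‖z‖ ^ (-a) := by positivity
    simp only [Pi.add_apply]
    rcases lt_or_ge ‖z‖ η with hlt | hge
    · have h1 : |u (x + z) - u x - inner ℝ p z| ≤ C₁ * powMin σ ‖z‖ := by
        refine (h z (hlt.trans_le hηη)).trans ?_
        rw [powMin_of_le_one (by linarith) hz0.le (hlt.le.trans hη1)]
        gcongr
        refine (le_abs_self C).trans (le_add_of_nonneg_right (by positivity))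
      calc _ ≤ C₁ * powMin σ ‖z‖ * ‖z‖ ^ (-a) := by gcongr
        _ = C₁ * (powMin σ ‖z‖ * ‖z‖ ^ (-a)) + 0 := by ring
        _ ≤ _ := by gcongr; positivity
    · have h0 := mul_le_powMin hσ1.le (by linarith) hη hη1 hge
      have h1 : |u x| + ‖p‖ * ‖z‖ ≤ C₁ * powMin σ ‖z‖ := by
        have e1 : |u x| = |u x| / η ^ 2 * (η * η) := by field_simp
        have e2 : ‖p‖ * ‖z‖ = ‖p‖ / η * (η * ‖z‖) := by field_simp
        have e3 : η * η ≤ powMin σ ‖z‖ := le_trans (by gcongr) h0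
        calc |u x| + ‖p‖ * ‖z‖ = |u x| / η ^ 2 * (η * η) + ‖p‖ / η * (η * ‖z‖) := by
              rw [← e1, ← e2]
          _ ≤ |u x| / η ^ 2 * powMin σ ‖z‖ + ‖p‖ / η * powMin σ ‖z‖ := by gcongr
          _ ≤ C₁ * powMin σ ‖z‖ := by
              have : 0 ≤ |C| * powMin σ ‖z‖ := by positivity
              simp only [C₁]
              linarith
      have h2 : |u (x + z) - u x - inner ℝ p z| ≤ |u (x + z)| + C₁ * powMin σ ‖z‖ := by
        have := abs_real_inner_le_norm p z
        calc _ ≤ |u (x + z)| + |u x| + |inner ℝ p z| :=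
              (abs_sub _ _).trans (add_le_add_left (abs_sub _ _) _)
          _ ≤ _ := by linarith
      calc _ ≤ (|u (x + z)| + C₁ * powMin σ ‖z‖) * ‖z‖ ^ (-a) := by gcongr
        _ = C₁ * (powMin σ ‖z‖ * ‖z‖ ^ (-a)) + |u (x + z)| * ‖z‖ ^ (-a) := by ring
        _ ≤ C₁ * (powMin σ ‖z‖ * ‖z‖ ^ (-a)) +
            |u (x + z)| * (D * (1 + ‖x + z‖) ^ (-a)) := by
            gcongr
            exact rpow_neg_norm_le_translate ha hη x z hge
        _ = _ := by
            rw [norm_mul, Real.norm_eq_abs, Real.norm_eq_abs,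
              abs_of_pos (one_add_norm_rpow_pos _ (x + z))]
            ring

/-- For symmetric kernels and order above one, the cut-off in the drift correction is immaterial. -/
lemma HasC11Slope.linOp_eq {lam Lam : ℝ} (hn : 1 ≤ n) (hσ1 : 1 < σ)
    (hσ : σ < 2 * s) (hs1 : s < 1)
    {u : EuclideanSpace ℝ (Fin n) → ℝ} {x p : EuclideanSpace ℝ (Fin n)} (h : HasC11Slope u x p)
    (hu : InWeightedL1 s u) {K : EuclideanSpace ℝ (Fin n) → ℝ}
    (hK : K ∈ symKernels n s lam Lam) :
    linOp s K u x = ∫ z, (u (x + z) - u x - inner ℝ p z) * K z := by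
  have hI := h.integrable_increment hn hσ1 hσ hs1 hu hK
  set T : EuclideanSpace ℝ (Fin n) → ℝ := fun z => if ‖z‖ < 1 then 0 else inner ℝ p z
  have hTm : Measurable T :=
    Measurable.ite (measurableSet_lt measurable_norm measurable_const) measurable_const
      (by fun_prop)
  have hT : Integrable (fun z => T z * K z) := by
    refine integrable_mul_kernel hK hTm.aestronglyMeasurable (by simp [T])
      ((integrable_powMin_mul_rpow (n := n) hn hσ hs1).const_mul ‖p‖) ?_
    intro z hz
    rw [← mul_assoc]
    gcongr
    simp only [T]
    split_ifs with h1
    · have := powMin_nonneg (σ := σ) (norm_nonneg z)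
      simp only [abs_zero]
      positivity
    · have h0 := mul_le_powMin hσ1.le (by linarith) one_pos le_rfl (not_lt.1 h1)
      rw [one_mul] at h0
      exact (abs_real_inner_le_norm p z).trans (by gcongr)
  -- `T` is odd and `K` is even.
  have hT0 : ∫ z, T z * K z = 0 := by
    have h1 := integral_neg_eq_self (fun z => T z * K z) volume
    have h2 : (fun z => T (-z) * K (-z)) = fun z => -(T z * K z) := by
      funext z
      rcases eq_or_ne z 0 with rfl | hz
      · simp [T]
      · rw [(hK.2 z hz).2.2.2]
        simp only [T, norm_neg, inner_neg_right]
        split_ifs <;> ring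
    rw [h2, integral_neg] at h1
    linarith
  have hsum := integral_add hI hT
  rw [hT0, add_zero] at hsum
  rw [linOp, h.hasGradientAt.gradient, ← hsum]
  congr 1
  funext z
  have h1 : (1 ≤ 2 * s ∧ 2 * s < 2) := ⟨by linarith, by linarith⟩
  simp only [T, h1, and_self, true_and]
  split_ifs <;> ring

lemma nonempty_symKernels {lam Lam : ℝ} (hlam : 0 < lam) (hLam : lam ≤ Lam) :
    Nonempty (symKernels n s lam Lam) := by
  refine ⟨⟨fun z => lam / ‖z‖ ^ ((n : ℝ) + 2 * s), ?_, fun z hz => ⟨?_, le_rfl, ?_, ?_⟩⟩⟩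
  · fun_prop
  · positivity
  · exact div_le_div_of_nonneg_right hLam (by positivity)
  · simp

/-- Comparison of the operator at two points, from a one-sided bound on the difference of the
second order increments. -/
lemma IsSymEllipticOperator.sub_le {lam Lam : ℝ} (hn : 1 ≤ n) (hσ1 : 1 < σ)
    (hσ : σ < 2 * s) (hs1 : s < 1) (hlam : 0 < lam) (hLam : lam ≤ Lam)
    {I : (EuclideanSpace ℝ (Fin n) → ℝ) → EuclideanSpace ℝ (Fin n) → ℝ}
    (hI : IsSymEllipticOperator s lam Lam I)
    {f₁ f₂ : EuclideanSpace ℝ (Fin n) → ℝ} {x₁ x₂ p₁ p₂ : EuclideanSpace ℝ (Fin n)}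
    (h₁ : HasC11Slope f₁ x₁ p₁) (hf₁ : InWeightedL1 s f₁)
    (h₂ : HasC11Slope f₂ x₂ p₂) (hf₂ : InWeightedL1 s f₂)
    {B : EuclideanSpace ℝ (Fin n) → ℝ} (hB0 : ∀ z, 0 ≤ B z)
    (hB : Integrable (fun z => B z * ‖z‖ ^ (-((n : ℝ) + 2 * s))))
    (hle : ∀ z, (f₁ (x₁ + z) - f₁ x₁ - inner ℝ p₁ z) - (f₂ (x₂ + z) - f₂ x₂ - inner ℝ p₂ z) ≤ B z) :
    I f₁ x₁ - I f₂ x₂ ≤ Lam * ∫ z, B z * ‖z‖ ^ (-((n : ℝ) + 2 * s)) := by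
  -- Translating `f₁` puts both evaluations at `x₂`, where ellipticity lets one and the same kernel
  -- act on both increments.
  set g : EuclideanSpace ℝ (Fin n) → ℝ := fun y => f₁ (y + (x₁ - x₂)) with hg
  have e : x₂ + (x₁ - x₂) = x₁ := by abel
  have ez : ∀ z, x₂ + z + (x₁ - x₂) = x₁ + z := fun z => by abel
  have hgs : HasC11Slope g x₂ p₁ := by
    obtain ⟨C, η, hη, h⟩ := h₁
    exact ⟨C, η, hη, fun z hz => by simpa only [hg, e, ez] using h z hz⟩
  have hadm₁ : Admissible s f₁ (x₂ + (x₁ - x₂)) := by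
    rw [e]
    exact ⟨⟨p₁, h₁⟩, hf₁⟩
  have htr := hI.translation f₁ x₂ (x₁ - x₂) hadm₁
  rw [e] at htr
  have hgw : InWeightedL1 s g := by
    have h0 : 0 ≤ (n : ℝ) + 2 * s := by
      have : (0 : ℝ) ≤ n := n.cast_nonneg
      linarith
    have h1 := (hf₁.integrable_translate (x₁ - x₂)).norm.const_mul
      ((1 + ‖x₁ - x₂‖) ^ ((n : ℝ) + 2 * s))
    refine h1.mono' ?_ (Eventually.of_forall fun z => ?_)
    · refine AEStronglyMeasurable.mul ?_ (Measurable.aestronglyMeasurable (by fun_prop))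
      have := hf₁.aestronglyMeasurable_translate (x₁ - x₂)
      simpa only [hg, add_comm] using this
    · have hp : 0 < 1 + ‖z‖ := by positivity
      have hp' : 0 < 1 + ‖(x₁ - x₂) + z‖ := by positivity
      have hq : 0 < 1 + ‖x₁ - x₂‖ := by positivity
      have h3 : 1 + ‖(x₁ - x₂) + z‖ ≤ (1 + ‖x₁ - x₂‖) * (1 + ‖z‖) := by
        nlinarith [norm_add_le (x₁ - x₂) z, norm_nonneg (x₁ - x₂), norm_nonneg z,
          mul_nonneg (norm_nonneg (x₁ - x₂)) (norm_nonneg z)]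
      have h4 := Real.rpow_le_rpow hp'.le h3 h0
      rw [Real.mul_rpow hq.le hp.le] at h4
      have h2 : (1 + ‖z‖) ^ (-((n : ℝ) + 2 * s)) ≤
          (1 + ‖x₁ - x₂‖) ^ ((n : ℝ) + 2 * s) *
            (1 + ‖(x₁ - x₂) + z‖) ^ (-((n : ℝ) + 2 * s)) := by
        rw [Real.rpow_neg hp.le, Real.rpow_neg hp'.le, ← div_eq_mul_inv, inv_eq_one_div,
          div_le_div_iff₀ (by positivity) (by positivity), one_mul]
        exact h4
      rw [norm_mul, norm_mul, Real.norm_of_nonneg (one_add_norm_rpow_pos _ z).le,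
        Real.norm_of_nonneg (one_add_norm_rpow_pos _ ((x₁ - x₂) + z)).le]
      simp only [hg]
      rw [add_comm z]
      calc _ ≤ ‖f₁ (x₁ - x₂ + z)‖ * ((1 + ‖x₁ - x₂‖) ^ ((n : ℝ) + 2 * s) *
            (1 + ‖(x₁ - x₂) + z‖) ^ (-((n : ℝ) + 2 * s))) := by gcongr
        _ = _ := by ring
  rw [← htr]
  refine (hI.elliptic_upper g f₂ x₂ ⟨⟨p₁, hgs⟩, hgw⟩ ⟨⟨p₂, h₂⟩, hf₂⟩).trans ?_
  have := nonempty_symKernels (n := n) (s := s) hlam hLam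
  refine ciSup_le fun K => ?_
  rw [hgs.linOp_eq hn hσ1 hσ hs1 hgw K.2, h₂.linOp_eq hn hσ1 hσ hs1 hf₂ K.2,
    ← integral_sub (hgs.integrable_increment hn hσ1 hσ hs1 hgw K.2)
      (h₂.integrable_increment hn hσ1 hσ hs1 hf₂ K.2), ← integral_const_mul]
  refine integral_mono ((hgs.integrable_increment hn hσ1 hσ hs1 hgw K.2).sub
    (h₂.integrable_increment hn hσ1 hσ hs1 hf₂ K.2)) (hB.const_mul Lam) fun z => ?_
  simp only [hg, ez, e]
  -- The kernel is unconstrained at the origin, but the increments vanish there.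
  rcases eq_or_ne z 0 with rfl | hz
  · have h0 := mul_nonneg (hlam.le.trans hLam) (mul_nonneg (hB0 0) (Real.rpow_nonneg
      (norm_nonneg (0 : EuclideanSpace ℝ (Fin n))) (-((n : ℝ) + 2 * s))))
    simpa using h0
  · have h0 := (K.2.2 z hz).1
    calc _ = ((f₁ (x₁ + z) - f₁ x₁ - inner ℝ p₁ z) - (f₂ (x₂ + z) - f₂ x₂ - inner ℝ p₂ z))
          * K.1 z := by ring
      _ ≤ B z * K.1 z := by gcongr; exact hle z
      _ ≤ B z * (Lam * ‖z‖ ^ (-((n : ℝ) + 2 * s))) := by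
          gcongr
          · exact hB0 z
          · exact symKernels_le K.2 hz
      _ = _ := by ring

end

/-! ### Test functions, gluing and scaling of the modulus -/

section

variable {n : ℕ} {s σ : ℝ}

lemma hasC11Slope_of_contDiffAt {f : EuclideanSpace ℝ (Fin n) → ℝ}
    {x : EuclideanSpace ℝ (Fin n)} (hf : ContDiffAt ℝ 2 f x) :
    HasC11Slope f x (gradient f x) := by
  have h1 : ContDiffAt ℝ 1 (fderiv ℝ f) x := hf.fderiv_right (by norm_num)
  obtain ⟨L, t, ht, hL⟩ := h1.exists_lipschitzOnWith
  have hd : ∀ᶠ y in 𝓝 x, DifferentiableAt ℝ f y :=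
    (hf.eventually (by simp)).mono fun y hy => hy.differentiableAt (by norm_num)
  obtain ⟨η, hη, hball⟩ := Metric.mem_nhds_iff.1 (Filter.inter_mem ht hd)
  refine ⟨L, η, hη, fun z hz => ?_⟩
  have hzη : ‖z‖ < η := hz
  have hsub : closedBall x ‖z‖ ⊆ ball x η := closedBall_subset_ball hzη
  have hx : x ∈ closedBall x ‖z‖ := mem_closedBall_self (norm_nonneg _)
  have hxz : x + z ∈ closedBall x ‖z‖ := by simp
  have := (convex_closedBall x ‖z‖).norm_image_sub_le_of_norm_fderiv_le' (𝕜 := ℝ) (f := f)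
    (φ := fderiv ℝ f x) (C := L * ‖z‖) (fun y hy => (hball (hsub hy)).2) (fun y hy => ?_) hx hxz
  · rw [add_sub_cancel_left, Real.norm_eq_abs] at this
    rw [inner_gradient_left]
    calc _ ≤ _ := this
      _ = _ := by ring
  · have h2 := hL.norm_sub_le (hball (hsub hy)).1 (hball (hsub hx)).1
    refine h2.trans ?_
    gcongr
    simpa [dist_eq_norm] using hy

lemma glue_center (u φ : EuclideanSpace ℝ (Fin n) → ℝ) (x : EuclideanSpace ℝ (Fin n)) {r : ℝ}
    (hr : 0 < r) : glue u φ x r x = φ x := by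
  simp [glue, hr]

lemma glue_add_of_lt (u φ : EuclideanSpace ℝ (Fin n) → ℝ) (x : EuclideanSpace ℝ (Fin n))
    {z : EuclideanSpace ℝ (Fin n)} {r : ℝ} (hz : ‖z‖ < r) :
    glue u φ x r (x + z) = φ (x + z) := by
  simp [glue, hz]

lemma glue_add_of_le (u φ : EuclideanSpace ℝ (Fin n) → ℝ) (x : EuclideanSpace ℝ (Fin n))
    {z : EuclideanSpace ℝ (Fin n)} {r : ℝ} (hz : r ≤ ‖z‖) :
    glue u φ x r (x + z) = u (x + z) := by
  simp [glue, not_lt.2 hz]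

lemma HasC11Slope.glue {φ : EuclideanSpace ℝ (Fin n) → ℝ} {x p : EuclideanSpace ℝ (Fin n)}
    (h : HasC11Slope φ x p) (u : EuclideanSpace ℝ (Fin n) → ℝ) {r : ℝ} (hr : 0 < r) :
    HasC11Slope (glue u φ x r) x p := by
  obtain ⟨C, η, hη, h⟩ := h
  refine ⟨C, min η r, lt_min hη hr, fun z hz => ?_⟩
  rw [glue_center u φ x hr, glue_add_of_lt u φ x (hz.trans_le (min_le_right _ _))]
  exact h z (hz.trans_le (min_le_left _ _))

lemma InWeightedL1.glue {u φ : EuclideanSpace ℝ (Fin n) → ℝ} (hu : InWeightedL1 s u)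
    (hφ : Continuous φ) (x : EuclideanSpace ℝ (Fin n)) (r : ℝ) :
    InWeightedL1 s (glue u φ x r) := by
  have hc : Continuous fun z : EuclideanSpace ℝ (Fin n) =>
      φ z * (1 + ‖z‖) ^ (-((n : ℝ) + 2 * s)) :=
    hφ.mul ((continuous_const.add continuous_norm).rpow_const fun z =>
      Or.inl (show 1 + ‖z‖ ≠ 0 by positivity))
  have h1 : IntegrableOn (fun z : EuclideanSpace ℝ (Fin n) =>
      φ z * (1 + ‖z‖) ^ (-((n : ℝ) + 2 * s))) (ball x r) :=
    (hc.locallyIntegrable.integrableOn_isCompact (isCompact_closedBall x r)).mono_set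
      ball_subset_closedBall
  have h2 : IntegrableOn (fun z : EuclideanSpace ℝ (Fin n) =>
      u z * (1 + ‖z‖) ^ (-((n : ℝ) + 2 * s))) (ball x r)ᶜ := Integrable.integrableOn hu
  refine ((h1.integrable_indicator measurableSet_ball).add
    (h2.integrable_indicator measurableSet_ball.compl)).congr (Eventually.of_forall fun z => ?_)
  by_cases hz : z ∈ ball x r
  · simp [NonlocalHJ.glue, hz, indicator]
  · simp [NonlocalHJ.glue, hz, indicator]

lemma powMin_div_mul_rpow {R : ℝ} (hR : 0 < R) (z : EuclideanSpace ℝ (Fin n)) :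
    powMin σ (‖z‖ / R) * ‖z‖ ^ (-((n : ℝ) + 2 * s)) = R ^ (-((n : ℝ) + 2 * s)) *
      (powMin σ ‖R⁻¹ • z‖ * ‖R⁻¹ • z‖ ^ (-((n : ℝ) + 2 * s))) := by
  have h1 : ‖R⁻¹ • z‖ = ‖z‖ / R := by
    rw [norm_smul, norm_inv, Real.norm_of_nonneg hR.le, inv_mul_eq_div]
  have h2 : ‖z‖ = R * (‖z‖ / R) := by field_simp
  rw [h1]
  conv_lhs => rw [h2, Real.mul_rpow hR.le (by positivity)]
  rw [mul_div_cancel_left₀ _ hR.ne']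
  ring

lemma integrable_powMin_div (hn : 1 ≤ n) (hσ : σ < 2 * s) (hs1 : s < 1) {R : ℝ} (hR : 0 < R) :
    Integrable (fun z : EuclideanSpace ℝ (Fin n) =>
      powMin σ (‖z‖ / R) * ‖z‖ ^ (-((n : ℝ) + 2 * s))) := by
  simp_rw [powMin_div_mul_rpow hR]
  exact ((integrable_powMin_mul_rpow hn hσ hs1).comp_smul (inv_ne_zero hR.ne')).const_mul _

/-- The source of the factor `R^(-2s)`: the operator has order `2s`. -/
lemma integral_powMin_div {R : ℝ} (hR : 0 < R) :
    ∫ z : EuclideanSpace ℝ (Fin n), powMin σ (‖z‖ / R) * ‖z‖ ^ (-((n : ℝ) + 2 * s)) =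
      R ^ (-(2 * s)) *
        ∫ z : EuclideanSpace ℝ (Fin n), powMin σ ‖z‖ * ‖z‖ ^ (-((n : ℝ) + 2 * s)) := by
  simp_rw [powMin_div_mul_rpow hR]
  rw [integral_const_mul, Measure.integral_comp_inv_smul_of_nonneg volume
    (fun z : EuclideanSpace ℝ (Fin n) => powMin σ ‖z‖ * ‖z‖ ^ (-((n : ℝ) + 2 * s))) hR.le,
    finrank_euclideanSpace, Fintype.card_fin, smul_eq_mul, ← mul_assoc,
    ← Real.rpow_natCast R n, ← Real.rpow_add hR]
  congr 2
  ring

lemma exists_radius_integral_ball_lt {f : EuclideanSpace ℝ (Fin n) → ℝ} (hn : 1 ≤ n)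
    (hf : Integrable f) {ε : ℝ} (hε : 0 < ε) :
    ∃ r₀ > 0, ∀ r, 0 < r → r ≤ r₀ → ∫ z in ball 0 r, f z < ε := by
  have hm : Tendsto (fun r : ℝ => volume (ball (0 : EuclideanSpace ℝ (Fin n)) r))
      (𝓝[>] 0) (𝓝 0) := by
    have : Nonempty (Fin n) := ⟨⟨0, hn⟩⟩
    simp_rw [EuclideanSpace.volume_ball]
    have : Tendsto (fun r : ℝ => ENNReal.ofReal r ^ Fintype.card (Fin n) * ENNReal.ofReal
        (√Real.pi ^ Fintype.card (Fin n) / Real.Gamma (Fintype.card (Fin n) / 2 + 1)))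
        (𝓝 0) (𝓝 0) := by
      have h1 : Tendsto (fun r : ℝ => ENNReal.ofReal r ^ Fintype.card (Fin n)) (𝓝 0) (𝓝 0) := by
        have h0 := ((ENNReal.continuous_pow (Fintype.card (Fin n))).comp ENNReal.continuous_ofReal).tendsto 0
        rw [Function.comp_apply, ENNReal.ofReal_zero, zero_pow (by simp; omega)] at h0
        exact h0
      simpa using ENNReal.Tendsto.mul_const h1 (Or.inr ENNReal.ofReal_ne_top)
    exact this.mono_left nhdsWithin_le_nhds
  have h := (hf.tendsto_setIntegral_nhds_zero hm).eventually (gt_mem_nhds hε)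
  rw [eventually_nhdsWithin_iff] at h
  obtain ⟨δ, hδ, h⟩ := Metric.eventually_nhds_iff.1 h
  refine ⟨δ / 2, by positivity, fun r hr hr' => h ?_ hr⟩
  rw [Real.dist_eq, sub_zero, abs_of_pos hr]
  linarith

/-! ### The localising weight and its increments -/

/-- The smooth weight `(1 + |x|²)^(σ/2)`. -/
def jap (σ : ℝ) (x : EuclideanSpace ℝ (Fin n)) : ℝ := (1 + ‖x‖ ^ 2) ^ (σ / 2)

/-- The gradient of `jap`. -/
def japGrad (σ : ℝ) (x : EuclideanSpace ℝ (Fin n)) : EuclideanSpace ℝ (Fin n) :=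
  (σ * (1 + ‖x‖ ^ 2) ^ (σ / 2 - 1)) • x

lemma one_le_one_add_norm_sq (x : EuclideanSpace ℝ (Fin n)) : 1 ≤ 1 + ‖x‖ ^ 2 := by
  nlinarith [sq_nonneg ‖x‖]

lemma contDiff_jap : ContDiff ℝ 2 (jap σ : EuclideanSpace ℝ (Fin n) → ℝ) :=
  (contDiff_const.add (contDiff_norm_sq ℝ)).rpow_const_of_ne fun x =>
    (zero_lt_one.trans_le (one_le_one_add_norm_sq x)).ne'

lemma hasGradientAt_jap (x : EuclideanSpace ℝ (Fin n)) :
    HasGradientAt (jap σ) (japGrad σ x) x := by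
  rw [hasGradientAt_iff_hasFDerivAt]
  have h1 := ((hasStrictFDerivAt_norm_sq x).hasFDerivAt.const_add 1).rpow_const (p := σ / 2)
    (Or.inl (zero_lt_one.trans_le (one_le_one_add_norm_sq x)).ne')
  refine h1.congr_fderiv ?_
  ext z
  simp [japGrad]
  ring

lemma one_le_jap (hσ : 0 ≤ σ) (x : EuclideanSpace ℝ (Fin n)) : 1 ≤ jap σ x :=
  Real.one_le_rpow (one_le_one_add_norm_sq x) (by positivity)

lemma rpow_le_tangent {r t θ : ℝ} (hr : 0 ≤ r) (ht : 0 < t) (h0 : 0 ≤ θ) (h1 : θ ≤ 1) :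
    r ^ θ ≤ t ^ θ + θ * t ^ (θ - 1) * (r - t) := by
  have h := rpow_one_add_le_one_add_mul_self (s := (r - t) / t)
    (by rw [le_div_iff₀ ht]; linarith) h0 h1
  have e : 1 + (r - t) / t = r / t := by field_simp; ring
  rw [e, Real.div_rpow hr ht.le, div_le_iff₀ (by positivity)] at h
  rw [Real.rpow_sub_one ht.ne']
  calc _ ≤ _ := h
    _ = _ := by ring

/-- The point is uniformity in `x`. Concavity of `t ↦ t^(σ/2)` bounds the increment by `T^(σ/2-1)
‖z‖²`, which suffices when `‖z‖ ≤ 1` or `‖z‖² ≤ T`. In the remaining case each term separately is of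
order `‖z‖^σ`; the constants 4 and 2 add up to 6. -/
lemma jap_increment_le (hσ1 : 1 < σ) (hσ2 : σ < 2) (x z : EuclideanSpace ℝ (Fin n)) :
    jap σ (x + z) - jap σ x - inner ℝ (japGrad σ x) z ≤ 6 * powMin σ ‖z‖ := by
  set T := 1 + ‖x‖ ^ 2 with hT
  have hT1 : 1 ≤ T := one_le_one_add_norm_sq x
  have hT0 : 0 < T := by linarith
  have hpow : 0 ≤ T ^ (σ / 2 - 1) := by positivity
  have hexp : ‖x + z‖ ^ 2 = ‖x‖ ^ 2 + 2 * inner ℝ x z + ‖z‖ ^ 2 := norm_add_sq_real x z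
  have hin : inner ℝ (japGrad σ x) z = σ * T ^ (σ / 2 - 1) * inner ℝ x z := by
    rw [japGrad, inner_smul_left]
    simp [hT]
  have hquad : jap σ (x + z) - jap σ x - inner ℝ (japGrad σ x) z ≤
      T ^ (σ / 2 - 1) * ‖z‖ ^ 2 := by
    have h := rpow_le_tangent (r := 1 + ‖x + z‖ ^ 2) (t := T) (θ := σ / 2) (by positivity) hT0
      (by linarith) (by linarith)
    have e : 1 + ‖x + z‖ ^ 2 - T = 2 * inner ℝ x z + ‖z‖ ^ 2 := by
      rw [hexp, hT]
      ring
    rw [e] at h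
    rw [hin]
    simp only [jap]
    have h2 : σ / 2 * (T ^ (σ / 2 - 1) * ‖z‖ ^ 2) ≤ 1 * (T ^ (σ / 2 - 1) * ‖z‖ ^ 2) := by
      gcongr
      linarith
    linarith
  rcases le_total ‖z‖ 1 with hz | hz
  · rw [powMin_of_le_one hσ2.le (norm_nonneg _) hz]
    have h1 : T ^ (σ / 2 - 1) ≤ 1 := Real.rpow_le_one_of_one_le_of_nonpos hT1 (by linarith)
    have : T ^ (σ / 2 - 1) * ‖z‖ ^ 2 ≤ 1 * ‖z‖ ^ 2 := by gcongr
    nlinarith [sq_nonneg ‖z‖]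
  · rw [powMin_of_one_le hσ2.le hz]
    have hz0 : 0 < ‖z‖ := by linarith
    have hzσ : 0 < ‖z‖ ^ σ := by positivity
    have hsq : ∀ θ : ℝ, (‖z‖ ^ 2) ^ θ = ‖z‖ ^ (2 * θ) := fun θ => by
      rw [← Real.rpow_natCast ‖z‖ 2, ← Real.rpow_mul hz0.le]
      norm_num
    rcases le_total (‖z‖ ^ 2) T with h | h
    · have h1 : T ^ (σ / 2 - 1) ≤ (‖z‖ ^ 2) ^ (σ / 2 - 1) :=
        Real.rpow_le_rpow_of_nonpos (by positivity) h (by linarith)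
      have h2 : T ^ (σ / 2 - 1) * ‖z‖ ^ 2 ≤ ‖z‖ ^ σ := by
        calc _ ≤ (‖z‖ ^ 2) ^ (σ / 2 - 1) * ‖z‖ ^ 2 := by gcongr
          _ = ‖z‖ ^ σ := by
            rw [hsq, ← Real.rpow_natCast ‖z‖ 2, ← Real.rpow_add hz0]
            congr 1
            push_cast
            ring
      linarith
    · have h1 : jap σ (x + z) ≤ 4 * ‖z‖ ^ σ := by
        have h2 : 1 + ‖x + z‖ ^ 2 ≤ 4 * ‖z‖ ^ 2 := by
          have h3 := norm_add_le x z
          have h4 : ‖x + z‖ ^ 2 ≤ (‖x‖ + ‖z‖) ^ 2 := by gcongr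
          nlinarith [sq_nonneg (‖x‖ - ‖z‖)]
        calc jap σ (x + z) ≤ (4 * ‖z‖ ^ 2) ^ (σ / 2) :=
              Real.rpow_le_rpow (by positivity) h2 (by linarith)
          _ = 4 ^ (σ / 2) * ‖z‖ ^ σ := by
              rw [Real.mul_rpow (by norm_num) (by positivity), hsq]
              ring_nf
          _ ≤ 4 ^ (1 : ℝ) * ‖z‖ ^ σ := by
              gcongr
              · norm_num
              · linarith
          _ = _ := by norm_num
      have h2 : -(σ * T ^ (σ / 2 - 1) * inner ℝ x z) ≤ 2 * ‖z‖ ^ σ := by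
        have h3 : -inner ℝ x z ≤ ‖x‖ * ‖z‖ :=
          (neg_le_abs _).trans (abs_real_inner_le_norm x z)
        have h4 : ‖x‖ ≤ T ^ (1 / 2 : ℝ) := by
          rw [← Real.sqrt_eq_rpow]
          exact Real.le_sqrt_of_sq_le (by linarith)
        have h5 : T ^ (σ / 2 - 1 + 1 / 2) ≤ (‖z‖ ^ 2) ^ (σ / 2 - 1 + 1 / 2) :=
          Real.rpow_le_rpow hT0.le h (by linarith)
        calc -(σ * T ^ (σ / 2 - 1) * inner ℝ x z)
            = σ * T ^ (σ / 2 - 1) * -inner ℝ x z := by ring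
          _ ≤ σ * T ^ (σ / 2 - 1) * (‖x‖ * ‖z‖) := by gcongr
          _ ≤ 2 * T ^ (σ / 2 - 1) * (T ^ (1 / 2 : ℝ) * ‖z‖) := by gcongr
          _ = 2 * (T ^ (σ / 2 - 1 + 1 / 2) * ‖z‖) := by
              rw [Real.rpow_add hT0]
              ring
          _ ≤ 2 * ((‖z‖ ^ 2) ^ (σ / 2 - 1 + 1 / 2) * ‖z‖) := by gcongr
          _ = 2 * ‖z‖ ^ σ := by
              rw [hsq]
              conv_lhs => rw [← Real.rpow_one ‖z‖, ← Real.rpow_mul hz0.le, ← Real.rpow_add hz0]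
              ring_nf
      have h3 := one_le_jap (zero_le_one.trans hσ1.le) x
      rw [hin]
      linarith

lemma norm_japGrad (hσ : 0 ≤ σ) (x : EuclideanSpace ℝ (Fin n)) :
    ‖japGrad σ x‖ = σ * (1 + ‖x‖ ^ 2) ^ (σ / 2 - 1) * ‖x‖ := by
  rw [japGrad, norm_smul, Real.norm_of_nonneg (by positivity)]

lemma norm_japGrad_le (hσ : 0 ≤ σ) (hσ2 : σ ≤ 2) (x : EuclideanSpace ℝ (Fin n)) :
    ‖japGrad σ x‖ ≤ 2 * jap σ x := by
  have hT1 : 1 ≤ 1 + ‖x‖ ^ 2 := one_le_one_add_norm_sq x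
  rw [norm_japGrad hσ, jap]
  have h4 : ‖x‖ ≤ 1 + ‖x‖ ^ 2 := by nlinarith [sq_nonneg (‖x‖ - 1)]
  calc _ ≤ 2 * (1 + ‖x‖ ^ 2) ^ (σ / 2 - 1) * (1 + ‖x‖ ^ 2) := by gcongr
    _ = _ := by
      rw [Real.rpow_sub_one (by positivity)]
      field_simp

/-- A crude lower bound: where the weight is bounded, its gradient is small only near the centre. -/
lemma norm_div_jap_le_norm_japGrad (hσ : 1 ≤ σ) (x : EuclideanSpace ℝ (Fin n)) :
    ‖x‖ / jap σ x ≤ ‖japGrad σ x‖ := by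
  have hT1 : 1 ≤ 1 + ‖x‖ ^ 2 := one_le_one_add_norm_sq x
  rw [norm_japGrad (by linarith), jap, div_eq_inv_mul, ← Real.rpow_neg (by positivity)]
  gcongr
  have : (1 + ‖x‖ ^ 2) ^ (-(σ / 2)) ≤ (1 + ‖x‖ ^ 2) ^ (σ / 2 - 1) :=
    Real.rpow_le_rpow_of_exponent_le hT1 (by linarith)
  have h2 : 0 ≤ (1 + ‖x‖ ^ 2) ^ (σ / 2 - 1) := by positivity
  nlinarith

end

/-! ### Consequences of the viscosity inequalities -/

section

variable {n : ℕ} {s σ : ℝ}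

/-- The total mass of the modulus `powMin σ` against the model kernel. -/
def powMinMass (n : ℕ) (s σ : ℝ) : ℝ :=
  ∫ z : EuclideanSpace ℝ (Fin n), powMin σ ‖z‖ * ‖z‖ ^ (-((n : ℝ) + 2 * s))

lemma powMinMass_nonneg : 0 ≤ powMinMass n s σ :=
  integral_nonneg fun z => mul_nonneg (powMin_nonneg (norm_nonneg z)) (by positivity)

lemma HasC11Slope.const_mul {f : EuclideanSpace ℝ (Fin n) → ℝ} {x p : EuclideanSpace ℝ (Fin n)}
    (h : HasC11Slope f x p) (c : ℝ) : HasC11Slope (fun y => c * f y) x (c • p) := by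
  obtain ⟨C, η, hη, h⟩ := h
  refine ⟨|c| * C, η, hη, fun z hz => ?_⟩
  have e : c * f (x + z) - c * f x - inner ℝ (c • p) z =
      c * (f (x + z) - f x - inner ℝ p z) := by
    rw [inner_smul_left]
    simp
    ring
  rw [e, abs_mul, mul_assoc]
  exact mul_le_mul_of_nonneg_left (h z hz) (abs_nonneg c)

lemma InWeightedL1.const_mul {f : EuclideanSpace ℝ (Fin n) → ℝ} (hf : InWeightedL1 s f) (c : ℝ) :
    InWeightedL1 s (fun y => c * f y) := by
  refine (Integrable.const_mul hf c).congr (Eventually.of_forall fun z => ?_)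
  simp only
  ring

lemma IsSymEllipticOperator.apply_zero {lam Lam : ℝ}
    {I : (EuclideanSpace ℝ (Fin n) → ℝ) → EuclideanSpace ℝ (Fin n) → ℝ}
    (hI : IsSymEllipticOperator s lam Lam I) (x : EuclideanSpace ℝ (Fin n)) :
    I (fun _ => 0) x = 0 := by
  have h := hI.homogeneous (fun _ => 0) x 2 two_pos
    ⟨⟨0, 0, 1, one_pos, fun z _ => by simp⟩, by simp [InWeightedL1]⟩
  simp only [mul_zero] at h
  linarith

variable {lam Lam m : ℝ} {I : (EuclideanSpace ℝ (Fin n) → ℝ) → EuclideanSpace ℝ (Fin n) → ℝ}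
  {u : EuclideanSpace ℝ (Fin n) → ℝ}

/-- A gradient bound at points where a subsolution is touched from above by a global test
function with controlled increments. -/
lemma IsViscositySubsolution.norm_gradient_rpow_le (hn : 1 ≤ n) (hσ1 : 1 < σ)
    (hσ : σ < 2 * s) (hs1 : s < 1) (hlam : 0 < lam) (hLam : lam ≤ Lam)
    (hI : IsSymEllipticOperator s lam Lam I)
    (hu : IsViscositySubsolution s I (fun p => ‖p‖ ^ m) u)
    {ψ : EuclideanSpace ℝ (Fin n) → ℝ} (hψ : ContDiff ℝ 2 ψ) {x p : EuclideanSpace ℝ (Fin n)}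
    (hp : HasGradientAt ψ p x) (hmax : ∀ y, u y - ψ y ≤ u x - ψ x) {H R : ℝ} (hH : 0 ≤ H)
    (hR : 0 < R) (hinc : ∀ z, ψ (x + z) - ψ x - inner ℝ p z ≤ H * powMin σ (‖z‖ / R)) :
    ‖p‖ ^ m ≤ Lam * (H * (R ^ (-(2 * s)) * powMinMass n s σ)) := by
  set φ : EuclideanSpace ℝ (Fin n) → ℝ := fun y => ψ y + (u x - ψ x) with hφ
  have hφc : ContDiff ℝ 2 φ := hψ.add contDiff_const
  have hφg : HasGradientAt φ p x := by
    rw [hasGradientAt_iff_hasFDerivAt] at hp ⊢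
    exact hp.add_const _
  have hφx : φ x = u x := by simp [hφ]
  have hw : InWeightedL1 s (glue u φ x 1) := hu.weighted.glue hφc.continuous x 1
  have htest := hu.test x 1 φ one_pos hφc.contDiffOn hw hφx.symm
    (fun y _ => by simp only [hφ]; linarith [hmax y])
  rw [hφg.gradient] at htest
  have hslope : HasC11Slope (glue u φ x 1) x p := by
    have := hasC11Slope_of_contDiffAt (hφc.contDiffAt (x := x))
    rw [hφg.gradient] at this
    exact this.glue u one_pos
  have h0 : HasC11Slope (fun _ : EuclideanSpace ℝ (Fin n) => (0 : ℝ)) x 0 :=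
    ⟨0, 1, one_pos, fun z _ => by simp⟩
  have hle := hI.sub_le hn hσ1 hσ hs1 hlam hLam hslope hw h0 (by simp [InWeightedL1])
    (B := fun z => H * powMin σ (‖z‖ / R))
    (fun z => mul_nonneg hH (powMin_nonneg (by positivity)))
    (by simpa only [mul_assoc] using (integrable_powMin_div hn hσ hs1 hR).const_mul H)
    (fun z => by
      rw [glue_center u φ x one_pos, hφx]
      -- Global touching puts the glued function below `φ` everywhere, so the growth of `ψ` matters
      -- only through `hinc`.
      have h1 : glue u φ x 1 (x + z) ≤ φ (x + z) := by
        rcases lt_or_ge ‖z‖ 1 with hz | hz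
        · rw [glue_add_of_lt u φ x hz]
        · rw [glue_add_of_le u φ x hz]
          simp only [hφ]
          linarith [hmax (x + z)]
      have h2 := hinc z
      simp only [hφ] at h1 ⊢
      simp only [inner_zero_left]
      linarith)
  simp only [mul_assoc] at hle
  rw [hI.apply_zero, integral_const_mul, integral_powMin_div hR] at hle
  unfold powMinMass
  linarith

/-- The doubling of variables inequality. -/
lemma IsViscositySolution.doubling (hn : 1 ≤ n) (hσ1 : 1 < σ)
    (hσ : σ < 2 * s) (hs1 : s < 1) (hlam : 0 < lam) (hLam : lam ≤ Lam)
    (hI : IsSymEllipticOperator s lam Lam I)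
    (hu : IsViscositySolution s I (fun p => ‖p‖ ^ m) u)
    {φ χ : EuclideanSpace ℝ (Fin n) → ℝ} {x y p q : EuclideanSpace ℝ (Fin n)}
    (hφ : Continuous φ) {ρ : ℝ} (hρ : 0 < ρ) (hφ2 : ContDiffOn ℝ 2 φ (ball (x - y) ρ))
    (hp : HasGradientAt φ p (x - y)) (hχ : ContDiff ℝ 2 χ) (hq : HasGradientAt χ q x)
    {μ : ℝ} (hμ : 0 < μ)
    (hmax : ∀ x' y', μ * u x' - u y' - φ (x' - y') - χ x' ≤ μ * u x - u y - φ (x - y) - χ x)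
    {H R : ℝ} (hH : 0 ≤ H) (hR : 0 < R)
    (hinc : ∀ z, χ (x + z) - χ x - inner ℝ q z ≤ H * powMin σ (‖z‖ / R)) :
    μ * ‖μ⁻¹ • (p + q)‖ ^ m - ‖p‖ ^ m ≤ Lam * (H * (R ^ (-(2 * s)) * powMinMass n s σ)) := by
  set a := x - y with ha
  have hφa : ContDiffAt ℝ 2 φ a := hφ2.contDiffAt (ball_mem_nhds a hρ)
  obtain ⟨C, η, hη, hC⟩ : HasC11Slope φ a p := by
    have := hasC11Slope_of_contDiffAt hφa
    rwa [hp.gradient] at this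
  have hC0 : 0 ≤ |C| := abs_nonneg C
  set φ₁ : EuclideanSpace ℝ (Fin n) → ℝ :=
    fun x' => u x + μ⁻¹ * ((φ (x' - y) - φ a) + (χ x' - χ x)) with hφ₁
  set φ₂ : EuclideanSpace ℝ (Fin n) → ℝ := fun y' => u y - (φ (x - y') - φ a) with hφ₂
  have hφ₁c : Continuous φ₁ := by
    have := hχ.continuous
    fun_prop
  have hφ₂c : Continuous φ₂ := by fun_prop
  have hφ₁x : φ₁ x = u x := by simp [hφ₁, ha]
  have hφ₂y : φ₂ y = u y := by simp [hφ₂, ha]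
  have hφ₁2 : ContDiffOn ℝ 2 φ₁ (ball x ρ) := by
    have h1 : ContDiffOn ℝ 2 (fun x' => φ (x' - y)) (ball x ρ) := by
      refine hφ2.comp (contDiff_id.sub contDiff_const).contDiffOn fun x' hx' => ?_
      have e : x' - y - a = x' - x := by rw [ha]; abel
      rw [mem_ball_iff_norm] at hx' ⊢
      exact (congrArg norm e).trans_lt hx'
    exact contDiffOn_const.add (contDiffOn_const.mul
      ((h1.sub contDiffOn_const).add (hχ.contDiffOn.sub contDiffOn_const)))
  have hφ₂2 : ContDiffOn ℝ 2 φ₂ (ball y ρ) := by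
    have h1 : ContDiffOn ℝ 2 (fun y' => φ (x - y')) (ball y ρ) := by
      refine hφ2.comp (contDiff_const.sub contDiff_id).contDiffOn fun y' hy' => ?_
      have e : x - y' - a = -(y' - y) := by rw [ha]; abel
      rw [mem_ball_iff_norm] at hy' ⊢
      exact ((congrArg norm e).trans (norm_neg _)).trans_lt hy'
    exact contDiffOn_const.sub (h1.sub contDiffOn_const)
  have hφ₁g : HasGradientAt φ₁ (μ⁻¹ • (p + q)) x := by
    rw [hasGradientAt_iff_hasFDerivAt] at hp hq ⊢
    have h1 : HasFDerivAt (fun x' => φ (x' - y)) (InnerProductSpace.toDual ℝ _ p) x :=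
      (hasFDerivAt_comp_sub y).2 hp
    refine ((((h1.sub_const (φ a)).add (hq.sub_const (χ x))).const_mul μ⁻¹).const_add
      (u x)).congr_fderiv ?_
    simp
  have hφ₂g : HasGradientAt φ₂ p y := by
    rw [hasGradientAt_iff_hasFDerivAt] at hp ⊢
    have h0 : HasFDerivAt (fun y' : EuclideanSpace ℝ (Fin n) => x - y')
      (-ContinuousLinearMap.id ℝ _) y := (hasFDerivAt_id y).const_sub x
    have h1 := HasFDerivAt.comp (g := φ) y hp h0
    refine ((h1.sub_const (φ a)).const_sub (u y)).congr_fderiv ?_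
    ext z
    simp
  have hs₁ : HasC11Slope φ₁ x (μ⁻¹ • (p + q)) := by
    have := hasC11Slope_of_contDiffAt (hφ₁2.contDiffAt (ball_mem_nhds x hρ))
    rwa [hφ₁g.gradient] at this
  have hs₂ : HasC11Slope φ₂ y p := by
    have := hasC11Slope_of_contDiffAt (hφ₂2.contDiffAt (ball_mem_nhds y hρ))
    rwa [hφ₂g.gradient] at this
  have hu₁ : ∀ x', u x' ≤ φ₁ x' := by
    intro x'
    have h1 := hmax x' y
    have h2 : μ * (u x' - u x) ≤ (φ (x' - y) - φ a) + (χ x' - χ x) := by linarith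
    have h3 : u x' - u x ≤ μ⁻¹ * ((φ (x' - y) - φ a) + (χ x' - χ x)) := by
      rwa [inv_mul_eq_div, le_div_iff₀ hμ, mul_comm]
    simp only [hφ₁]
    linarith
  have hu₂ : ∀ y', φ₂ y' ≤ u y' := by
    intro y'
    have h1 := hmax x y'
    simp only [hφ₂]
    linarith
  have hint := integrable_powMin_mul_rpow (n := n) hn hσ hs1
  -- Inside the gluing ball the two increments of `φ`, in directions `z` and `-z`, cost at most `2
  -- |C| ‖z‖²`. The integral of this cost over `B_r` vanishes as `r → 0`, so `C` leaves no trace in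
  -- the result.
  refine le_of_forall_pos_le_add fun ε hε => ?_
  have hLam0 : 0 < Lam := hlam.trans_le hLam
  obtain ⟨r₀, hr₀, hsmall⟩ := exists_radius_integral_ball_lt hn (hint.const_mul (2 * |C|))
    (div_pos hε hLam0)
  obtain ⟨r, hr, hr1, hrη, hrρ, hrr⟩ : ∃ r : ℝ, 0 < r ∧ r ≤ 1 ∧ r ≤ η ∧ r ≤ ρ ∧ r ≤ r₀ :=
    ⟨min (min 1 η) (min ρ r₀), lt_min (lt_min one_pos hη) (lt_min hρ hr₀),
      (min_le_left _ _).trans (min_le_left _ _), (min_le_left _ _).trans (min_le_right _ _),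
      (min_le_right _ _).trans (min_le_left _ _), (min_le_right _ _).trans (min_le_right _ _)⟩
  have hw₁ : InWeightedL1 s (glue u φ₁ x r) := hu.1.weighted.glue hφ₁c x r
  have hw₂ : InWeightedL1 s (glue u φ₂ y r) := hu.1.weighted.glue hφ₂c y r
  have ht₁ := hu.1.test x r φ₁ hr (hφ₁2.mono (ball_subset_ball hrρ)) hw₁ hφ₁x.symm
    (fun x' _ => hu₁ x')
  have ht₂ := hu.2.test y r φ₂ hr (hφ₂2.mono (ball_subset_ball hrρ)) hw₂ hφ₂y.symm
    (fun y' _ => hu₂ y')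
  rw [hφ₁g.gradient] at ht₁
  rw [hφ₂g.gradient] at ht₂
  have hhom := hI.homogeneous (glue u φ₁ x r) x μ hμ ⟨⟨_, hs₁.glue u hr⟩, hw₁⟩
  -- After multiplication by `μ` the slope is `p + q`, so that `p` cancels against the slope of
  -- `φ₂`.
  have hs₁' := (hs₁.glue u hr).const_mul μ
  rw [smul_smul, mul_inv_cancel₀ hμ.ne', one_smul] at hs₁'
  set S : EuclideanSpace ℝ (Fin n) → ℝ := (ball 0 r).indicator
    fun z => 2 * |C| * (powMin σ ‖z‖ * ‖z‖ ^ (-((n : ℝ) + 2 * s))) with hS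
  have hSi : Integrable S := (hint.const_mul (2 * |C|)).indicator measurableSet_ball
  set B : EuclideanSpace ℝ (Fin n) → ℝ := fun z => H * powMin σ (‖z‖ / R) +
    (ball (0 : EuclideanSpace ℝ (Fin n)) r).indicator (fun z => 2 * |C| * powMin σ ‖z‖) z with hB
  have hBeq : ∀ z : EuclideanSpace ℝ (Fin n), B z * ‖z‖ ^ (-((n : ℝ) + 2 * s)) =
      H * (powMin σ (‖z‖ / R) * ‖z‖ ^ (-((n : ℝ) + 2 * s))) + S z := by
    intro z
    by_cases hz : z ∈ ball (0 : EuclideanSpace ℝ (Fin n)) r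
    · simp only [hB, hS, indicator_of_mem hz]
      ring
    · simp only [hB, hS, indicator_of_notMem hz]
      ring
  have hRi := (integrable_powMin_div (n := n) hn hσ hs1 hR).const_mul H
  have hle := hI.sub_le hn hσ1 hσ hs1 hlam hLam hs₁' (hw₁.const_mul μ) (hs₂.glue u hr) hw₂
    (B := B)
    (fun z => by
      refine add_nonneg (mul_nonneg hH (powMin_nonneg (by positivity)))
        (indicator_nonneg (fun z _ => ?_) z)
      exact mul_nonneg (by positivity) (powMin_nonneg (norm_nonneg z)))
    (by
      simp_rw [hBeq]
      exact hRi.add hSi)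
    (fun z => by
      have h1 := hinc z
      rw [glue_center u φ₁ x hr, glue_center u φ₂ y hr, hφ₁x, hφ₂y, inner_add_left]
      rcases lt_or_ge ‖z‖ r with hz | hz
      · have hz' : z ∈ ball (0 : EuclideanSpace ℝ (Fin n)) r := by simpa using hz
        rw [glue_add_of_lt u φ₁ x hz, glue_add_of_lt u φ₂ y hz]
        have h2 := (le_abs_self _).trans (hC z (hz.trans_le hrη))
        have h3 := (le_abs_self _).trans (hC (-z) (by rw [norm_neg]; exact hz.trans_le hrη))
        rw [norm_neg, inner_neg_right] at h3
        have h4 : C * ‖z‖ ^ 2 ≤ |C| * ‖z‖ ^ 2 := by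
          gcongr
          exact le_abs_self C
        have e1 : x + z - y = a + z := by rw [ha]; abel
        have e2 : x - (y + z) = a + -z := by rw [ha]; abel
        have e3 : μ * φ₁ (x + z) - μ * u x =
            (φ (a + z) - φ a) + (χ (x + z) - χ x) := by
          simp only [hφ₁, e1]
          rw [mul_add, ← mul_assoc, mul_inv_cancel₀ hμ.ne']
          ring
        simp only [hB, indicator_of_mem hz']
        rw [powMin_of_le_one (by linarith) (norm_nonneg z) (hz.le.trans hr1), e3]
        simp only [hφ₂, e2]
        linarith
      · have hz' : z ∉ ball (0 : EuclideanSpace ℝ (Fin n)) r := by simpa using hz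
        rw [glue_add_of_le u φ₁ x hz, glue_add_of_le u φ₂ y hz]
        -- Moving both points by `z` keeps `x - y` fixed, so `φ` drops out and needs no growth
        -- condition.
        have h2 := hmax (x + z) (y + z)
        have e1 : x + z - (y + z) = a := by rw [ha]; abel
        rw [e1] at h2
        simp only [hB, indicator_of_notMem hz']
        linarith)
  simp_rw [hBeq] at hle
  rw [integral_add hRi hSi, integral_const_mul, integral_powMin_div hR, hS,
    integral_indicator measurableSet_ball, hhom, mul_add] at hle
  have h5 := hsmall r hr hrr
  rw [lt_div_iff₀ hLam0, mul_comm] at h5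
  have h6 := mul_le_mul_of_nonneg_left (a := μ) (by linarith : ‖μ⁻¹ • (p + q)‖ ^ m ≤
    I (glue u φ₁ x r) x) hμ.le
  unfold powMinMass
  linarith

end

/-! ### Rescaled weights, growth bounds and the cone -/

section

variable {n : ℕ} {s σ : ℝ}

/-- `jap`, rescaled by `R`, centred at `y` and multiplied by `H`. -/
def scaledJap (σ H R : ℝ) (y x : EuclideanSpace ℝ (Fin n)) : ℝ := H * jap σ (R⁻¹ • (x - y))

lemma contDiff_scaledJap (H R : ℝ) (y : EuclideanSpace ℝ (Fin n)) :
    ContDiff ℝ 2 (scaledJap σ H R y) :=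
  contDiff_const.mul (contDiff_jap.comp ((contDiff_id.sub contDiff_const).const_smul R⁻¹))

lemma hasGradientAt_scaledJap (H R : ℝ) (y x : EuclideanSpace ℝ (Fin n)) :
    HasGradientAt (scaledJap σ H R y) ((H * R⁻¹) • japGrad σ (R⁻¹ • (x - y))) x := by
  rw [hasGradientAt_iff_hasFDerivAt]
  have h1 := hasGradientAt_iff_hasFDerivAt.1 (hasGradientAt_jap (σ := σ) (R⁻¹ • (x - y)))
  have h2 : HasFDerivAt (fun x : EuclideanSpace ℝ (Fin n) => R⁻¹ • (x - y))
      (R⁻¹ • ContinuousLinearMap.id ℝ _) x := ((hasFDerivAt_id x).sub_const y).const_smul R⁻¹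
  refine ((HasFDerivAt.comp x h1 h2).const_mul H).congr_fderiv ?_
  ext z
  simp
  ring

lemma scaledJap_increment_le (hσ1 : 1 < σ) (hσ2 : σ < 2) {H R : ℝ} (hH : 0 ≤ H) (hR : 0 < R)
    (y x z : EuclideanSpace ℝ (Fin n)) :
    scaledJap σ H R y (x + z) - scaledJap σ H R y x -
      inner ℝ ((H * R⁻¹) • japGrad σ (R⁻¹ • (x - y))) z ≤ 6 * H * powMin σ (‖z‖ / R) := by
  have h := mul_le_mul_of_nonneg_left
    (jap_increment_le hσ1 hσ2 (R⁻¹ • (x - y)) (R⁻¹ • z)) hH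
  have e1 : R⁻¹ • (x - y) + R⁻¹ • z = R⁻¹ • (x + z - y) := by
    rw [← smul_add]
    congr 1
    abel
  have e2 : ‖R⁻¹ • z‖ = ‖z‖ / R := by
    rw [norm_smul, norm_inv, Real.norm_of_nonneg hR.le, inv_mul_eq_div]
  rw [e1, e2, inner_smul_right] at h
  rw [inner_smul_left]
  simp only [scaledJap, conj_trivial]
  linarith

lemma jap_le_one_add_sq (hσ2 : σ ≤ 2) (x : EuclideanSpace ℝ (Fin n)) :
    jap σ x ≤ 1 + ‖x‖ ^ 2 := by
  have := Real.rpow_le_rpow_of_exponent_le (one_le_one_add_norm_sq x)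
    (by linarith : σ / 2 ≤ 1)
  simpa [jap] using this

lemma norm_le_jap (hσ : 1 ≤ σ) (x : EuclideanSpace ℝ (Fin n)) : ‖x‖ ≤ jap σ x := by
  have h1 : ‖x‖ ≤ (1 + ‖x‖ ^ 2) ^ (1 / 2 : ℝ) := by
    rw [← Real.sqrt_eq_rpow]
    exact Real.le_sqrt_of_sq_le (by linarith)
  exact h1.trans (Real.rpow_le_rpow_of_exponent_le (one_le_one_add_norm_sq x) (by linarith))

/-- Controls the weight in the second variable by the weight in the first and a quadratic in the
difference, which the cone can absorb. -/
lemma jap_le_of_sub (hσ0 : 0 ≤ σ) (hσ2 : σ ≤ 2) (x y : EuclideanSpace ℝ (Fin n)) :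
    jap σ y ≤ 2 * jap σ x + 2 * (1 + ‖x - y‖ ^ 2) := by
  have h1 : 1 + ‖y‖ ^ 2 ≤ 2 * (1 + ‖x‖ ^ 2) + 2 * ‖x - y‖ ^ 2 := by
    have h2 : ‖y‖ ≤ ‖x‖ + ‖x - y‖ := by
      have := norm_sub_norm_le y x
      rw [norm_sub_rev] at this
      linarith
    have h3 : ‖y‖ ^ 2 ≤ (‖x‖ + ‖x - y‖) ^ 2 := by gcongr
    nlinarith [sq_nonneg (‖x‖ - ‖x - y‖)]
  have hθ0 : 0 ≤ σ / 2 := by linarith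
  have hθ1 : σ / 2 ≤ 1 := by linarith
  have hd : (2 * ‖x - y‖ ^ 2) ^ (σ / 2) ≤ 2 * (1 + ‖x - y‖ ^ 2) := by
    have h4 : (2 * ‖x - y‖ ^ 2) ^ (σ / 2) ≤ (2 * (1 + ‖x - y‖ ^ 2)) ^ (σ / 2) := by
      gcongr
      linarith
    have h5 := Real.rpow_le_rpow_of_exponent_le
      (by nlinarith [sq_nonneg ‖x - y‖] : 1 ≤ 2 * (1 + ‖x - y‖ ^ 2)) hθ1
    rw [Real.rpow_one] at h5
    exact h4.trans h5
  calc jap σ y ≤ (2 * (1 + ‖x‖ ^ 2) + 2 * ‖x - y‖ ^ 2) ^ (σ / 2) := by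
        unfold jap
        gcongr
    _ ≤ (2 * (1 + ‖x‖ ^ 2)) ^ (σ / 2) + (2 * ‖x - y‖ ^ 2) ^ (σ / 2) :=
        Real.rpow_add_le_add_rpow (by positivity) (by positivity) hθ0 hθ1
    _ ≤ 2 * jap σ x + 2 * (1 + ‖x - y‖ ^ 2) := by
        refine add_le_add ?_ hd
        rw [Real.mul_rpow (by norm_num) (by positivity)]
        unfold jap
        gcongr
        simpa using Real.rpow_le_rpow_of_exponent_le one_le_two hθ1

/-- Young's inequality: a power `θ = γ / σ < 1` of the weight lies below its tangent at `t`, whose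
slope is arbitrarily small for large `t`. -/
lemma exists_mul_one_add_norm_rpow_le {γ M h : ℝ} (hγ : 0 ≤ γ) (hγσ : γ < σ) (hM : 0 ≤ M)
    (hh : 0 < h) : ∃ N, 0 ≤ N ∧
      ∀ x : EuclideanSpace ℝ (Fin n), M * (1 + ‖x‖) ^ γ ≤ h * jap σ x + N := by
  have hσ : 0 < σ := hγ.trans_lt hγσ
  set θ := γ / σ with hθ
  have hθ0 : 0 ≤ θ := by positivity
  have hθ1 : θ < 1 := (div_lt_one hσ).2 hγσ
  set M' := M * 2 ^ (γ / 2) with hM'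
  have hM0 : 0 ≤ M' := by positivity
  obtain ⟨t, ht, ht0⟩ := (((tendsto_rpow_neg_atTop (by linarith : 0 < 1 - θ)).eventually
    (gt_mem_nhds (by positivity : 0 < h / (M' + 1)))).and (eventually_gt_atTop 0)).exists
  rw [lt_div_iff₀ (by positivity), neg_sub] at ht
  refine ⟨M' * t ^ θ, by positivity, fun x => ?_⟩
  have hJ0 : 0 ≤ jap σ x := by unfold jap; positivity
  have h1 : (1 + ‖x‖) ^ γ ≤ 2 ^ (γ / 2) * jap σ x ^ θ := by
    have h2 : (1 + ‖x‖) ^ γ = ((1 + ‖x‖) ^ 2) ^ (γ / 2) := by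
      rw [← Real.rpow_natCast, ← Real.rpow_mul (by positivity)]
      congr 1
      push_cast
      ring
    rw [h2, jap, ← Real.rpow_mul (by positivity), show σ / 2 * θ = γ / 2 by
      rw [hθ]; field_simp, ← Real.mul_rpow (by norm_num) (by positivity)]
    gcongr
    nlinarith [sq_nonneg (1 - ‖x‖)]
  have h3 := rpow_le_tangent hJ0 ht0 hθ0 hθ1.le
  have hp : 0 ≤ t ^ (θ - 1) := by positivity
  have h4 : jap σ x ^ θ ≤ t ^ θ + t ^ (θ - 1) * jap σ x := by
    have h5 : θ * t ^ (θ - 1) * (jap σ x - t) ≤ t ^ (θ - 1) * jap σ x := by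
      have e1 : 0 ≤ θ * t ^ (θ - 1) * t := by positivity
      have e2 : θ * (t ^ (θ - 1) * jap σ x) ≤ 1 * (t ^ (θ - 1) * jap σ x) := by gcongr
      linarith
    linarith
  calc M * (1 + ‖x‖) ^ γ ≤ M * (2 ^ (γ / 2) * jap σ x ^ θ) := by gcongr
    _ = M' * jap σ x ^ θ := by rw [hM']; ring
    _ ≤ M' * (t ^ θ + t ^ (θ - 1) * jap σ x) := by gcongr
    _ = (M' * t ^ (θ - 1)) * jap σ x + M' * t ^ θ := by ring
    _ ≤ h * jap σ x + M' * t ^ θ := by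
        gcongr
        linarith

lemma exists_abs_le_scaled {u : EuclideanSpace ℝ (Fin n) → ℝ} {γ M : ℝ} (hγ : 0 ≤ γ)
    (hγσ : γ < σ) (hgrowth : ∀ x, |u x| ≤ M * (1 + ‖x‖) ^ γ) {h : ℝ} (hh : 0 < h) :
    ∃ N, 0 ≤ N ∧ ∀ R, 1 ≤ R → ∀ y, ‖y‖ ≤ R → ∀ x,
      |u x| ≤ R ^ γ * (h * jap σ (R⁻¹ • (x - y)) + N) := by
  have hM : 0 ≤ M := by
    have := (abs_nonneg _).trans (hgrowth 0)
    simpa using this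
  obtain ⟨N, hN, hle⟩ := exists_mul_one_add_norm_rpow_le (n := n) hγ hγσ
    (by positivity : 0 ≤ M * 2 ^ γ) hh
  refine ⟨N, hN, fun R hR y hy x => (hgrowth x).trans ?_⟩
  have hR0 : 0 < R := by linarith
  set Z := R⁻¹ • (x - y) with hZ
  have hx : x = y + R • Z := by
    rw [hZ, smul_smul, mul_inv_cancel₀ hR0.ne', one_smul]
    abel
  have h1 : 1 + ‖x‖ ≤ 2 * R * (1 + ‖Z‖) := by
    have h2 := norm_add_le y (R • Z)
    rw [← hx, norm_smul, Real.norm_of_nonneg hR0.le] at h2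
    nlinarith [mul_nonneg hR0.le (norm_nonneg Z)]
  calc M * (1 + ‖x‖) ^ γ ≤ M * (2 * R * (1 + ‖Z‖)) ^ γ := by gcongr
    _ = R ^ γ * (M * 2 ^ γ * (1 + ‖Z‖) ^ γ) := by
        rw [Real.mul_rpow (by positivity) (by positivity), Real.mul_rpow (by norm_num) hR0.le]
        ring
    _ ≤ _ := by
        gcongr
        exact hle Z

/-- The cone with a quadratic correction `c (|z|/R + |z|²/R²)`. -/
def coneQuad (c R : ℝ) (z : EuclideanSpace ℝ (Fin n)) : ℝ := c * (‖z‖ / R + (‖z‖ / R) ^ 2)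

lemma continuous_coneQuad (c R : ℝ) :
    Continuous (coneQuad c R : EuclideanSpace ℝ (Fin n) → ℝ) := by
  unfold coneQuad
  fun_prop

lemma contDiffOn_coneQuad (c R : ℝ) (a : EuclideanSpace ℝ (Fin n)) :
    ContDiffOn ℝ 2 (coneQuad c R) (ball a ‖a‖) := by
  intro z hz
  have hz0 : z ≠ 0 := by
    rintro rfl
    simp at hz
  have h1 : ContDiffAt ℝ 2 (fun z : EuclideanSpace ℝ (Fin n) => ‖z‖ / R) z :=
    (contDiffAt_norm ℝ hz0).div_const R
  exact (contDiffAt_const.mul (h1.add (h1.pow 2))).contDiffWithinAt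

/-- Differentiate along the ray through `a`; the quadratic correction only increases the radial
slope. -/
lemma le_norm_gradient_coneQuad {c R : ℝ} (hc : 0 ≤ c) (hR : 0 < R)
    {a p : EuclideanSpace ℝ (Fin n)} (ha : a ≠ 0) (hp : HasGradientAt (coneQuad c R) p a) :
    c * R⁻¹ ≤ ‖p‖ := by
  have ha0 : 0 < ‖a‖ := norm_pos_iff.2 ha
  have h1 : HasDerivAt (fun t : ℝ => t • a) a 1 := by
    simpa using (hasDerivAt_id (1 : ℝ)).smul_const a
  have hp' : HasFDerivAt (coneQuad c R) (InnerProductSpace.toDual ℝ _ p) ((1 : ℝ) • a) := by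
    rw [one_smul]
    exact hasGradientAt_iff_hasFDerivAt.1 hp
  have h2 := hp'.comp_hasDerivAt 1 h1
  have h3 : HasDerivAt (fun t : ℝ => c * (t * (‖a‖ / R) + (t * (‖a‖ / R)) ^ 2))
      (c * (‖a‖ / R + 2 * (‖a‖ / R) ^ 2)) 1 := by
    have h4 : HasDerivAt (fun t : ℝ => t * (‖a‖ / R)) (‖a‖ / R) 1 := by
      simpa using (hasDerivAt_id (1 : ℝ)).mul_const (‖a‖ / R)
    refine ((h4.add (h4.pow 2)).const_mul c).congr_deriv ?_
    rw [Nat.add_one_sub_one, pow_one]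
    push_cast
    ring
  have h5 : HasDerivAt (coneQuad c R ∘ fun t : ℝ => t • a)
      (c * (‖a‖ / R + 2 * (‖a‖ / R) ^ 2)) 1 := by
    refine h3.congr_of_eventuallyEq ?_
    filter_upwards [lt_mem_nhds (zero_lt_one (α := ℝ))] with t ht
    simp only [Function.comp_apply, coneQuad, norm_smul, Real.norm_of_nonneg ht.le]
    ring
  have h6 := h2.unique h5
  rw [InnerProductSpace.toDual_apply_apply] at h6
  have h7 := real_inner_le_norm p a
  rw [h6] at h7
  have h8 : c * R⁻¹ * ‖a‖ ≤ ‖p‖ * ‖a‖ := by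
    have : 0 ≤ c * (2 * (‖a‖ / R) ^ 2) := by positivity
    calc c * R⁻¹ * ‖a‖ = c * (‖a‖ / R) := by ring
      _ ≤ _ := by linarith
  exact le_of_mul_le_mul_right h8 ha0

end

/-! ### Uniform modulus of continuity and decay of oscillation -/

section

variable {n : ℕ} {s σ lam Lam m γ M : ℝ}
  {I : (EuclideanSpace ℝ (Fin n) → ℝ) → EuclideanSpace ℝ (Fin n) → ℝ}
  {u : EuclideanSpace ℝ (Fin n) → ℝ}

lemma IsViscositySolution.continuous {H : EuclideanSpace ℝ (Fin n) → ℝ}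
    (hu : IsViscositySolution s I H u) : Continuous u :=
  continuous_iff_lower_upperSemicontinuous.2 ⟨hu.2.semicontinuous, hu.1.semicontinuous⟩

lemma norm_inv_smul {R : ℝ} (hR : 0 < R) (z : EuclideanSpace ℝ (Fin n)) :
    ‖R⁻¹ • z‖ = ‖z‖ / R := by
  rw [norm_smul, norm_inv, Real.norm_of_nonneg hR.le, inv_mul_eq_div]

lemma jap_inv_smul_le_five (hσ2 : σ ≤ 2) {R : ℝ} (hR : 0 < R) {x : EuclideanSpace ℝ (Fin n)}
    (hx : ‖x‖ ≤ 2 * R) : jap σ (R⁻¹ • x) ≤ 5 := by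
  refine (jap_le_one_add_sq hσ2 _).trans ?_
  have h : ‖R⁻¹ • x‖ ≤ 2 := by
    rw [norm_inv_smul hR, div_le_iff₀ hR]
    exact hx
  nlinarith [norm_nonneg (R⁻¹ • x)]

/-- `μ^(1-m) > 1` because `m > 1`. Half of this exponent is kept as the gain `d`; the other half
pays for `θ < 1`, which leaves room for the gradient of the localising weight. -/
lemma exists_contraction_gain {μ : ℝ} (hμ0 : 0 < μ) (hμ1 : μ < 1) (hm : 1 < m) :
    ∃ θ d : ℝ, 0 < θ ∧ θ < 1 ∧ 0 < d ∧ μ * (μ⁻¹ * θ) ^ m = 1 + d := by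
  have hm0 : 0 < m := by linarith
  refine ⟨μ ^ ((m - 1) / (2 * m)), μ ^ (-((m - 1) / 2)) - 1, by positivity,
    Real.rpow_lt_one hμ0.le hμ1 (div_pos (by linarith) (by linarith)), ?_, ?_⟩
  · have := Real.one_lt_rpow_of_pos_of_lt_one_of_neg hμ0 hμ1
      (by linarith : -((m - 1) / 2) < 0)
    linarith
  · rw [Real.mul_rpow (by positivity) (by positivity), ← Real.rpow_mul hμ0.le,
      ← Real.rpow_neg_one, ← Real.rpow_mul hμ0.le, ← Real.rpow_add hμ0]
    conv_lhs => rw [← Real.rpow_one μ, ← Real.rpow_mul hμ0.le, ← Real.rpow_add hμ0]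
    rw [add_sub_cancel]
    congr 1
    field_simp
    ring

set_option maxHeartbeats 1000000 in
/-- The doubled function stays below the cone, uniformly in the scale `R`. -/
lemma IsViscositySolution.exists_cone_bound (hn : 1 ≤ n) (hσ1 : 1 < σ)
    (hσ : σ < 2 * s) (hs1 : s < 1) (hlam : 0 < lam) (hLam : lam ≤ Lam) (hm : 1 < m)
    (hI : IsSymEllipticOperator s lam Lam I)
    (hu : IsViscositySolution s I (fun p => ‖p‖ ^ m) u)
    (hγm : γ - 2 * s ≤ m * (γ - 1)) {h N κ : ℝ} (hh : 0 < h) (hN : 0 ≤ N)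
    (hκ0 : 0 < κ) (hκ1 : κ < 1)
    (hbound : ∀ R, 1 ≤ R → ∀ y, ‖y‖ ≤ R → ∀ x,
      |u x| ≤ R ^ γ * (h / 4 * jap σ (R⁻¹ • (x - y)) + N)) :
    ∃ A, 0 ≤ A ∧ ∀ R, 1 ≤ R → ∀ x y,
      (1 - κ) * (u x + N * R ^ γ) - (u y + N * R ^ γ) ≤
        coneQuad (A * R ^ γ) R (x - y) + scaledJap σ (h * R ^ γ) R 0 x := by
  have hσ2 : σ < 2 := by linarith
  have hμ0 : 0 < 1 - κ := by linarith
  obtain ⟨θ, d, hθ0, hθ1, hd, hθd⟩ := exists_contraction_gain hμ0 (by linarith) hm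
  have hLam0 : 0 ≤ Lam := (hlam.trans_le hLam).le
  have hJ : 0 ≤ powMinMass n s σ := powMinMass_nonneg
  -- Bound, in units of `R`, for the region where the doubled function is positive; see `hloc`.
  set G : ℝ := 2 + 8 * N / h with hG
  have hG0 : 0 ≤ G := by positivity
  set Q : ℝ := h * (2 * G) with hQ
  set D : ℝ := Lam * (6 * h * powMinMass n s σ) with hD
  have hD0 : 0 ≤ D := by positivity
  have h1θ : 0 < 1 - θ := by linarith
  -- The summands give, in order, `A ≤ A^m` (and the strictness of `D < d A`), domination of the
  -- quadratic growth in `y`, `‖q‖ ≤ (1 - θ) ‖p‖`, and a gain above the localisation error. None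
  -- depends on `R`.
  set A : ℝ := 1 + h + Q / (1 - θ) + D / d with hA
  have hQ0 : 0 ≤ Q / (1 - θ) := by positivity
  have hDd0 : 0 ≤ D / d := by positivity
  have hA1 : 1 ≤ A := by linarith
  have hAh : h ≤ A := by linarith
  have hAQ : Q ≤ (1 - θ) * A := by
    have : Q / (1 - θ) ≤ A := by linarith
    rwa [div_le_iff₀ h1θ, mul_comm] at this
  have hAD : D < d * A := by
    have : D / d < A := by linarith
    rwa [div_lt_iff₀ hd, mul_comm] at this
  refine ⟨A, by linarith, fun R hR x₀ y₀ => ?_⟩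
  have hR0 : 0 < R := by linarith
  have hRγ : 0 < R ^ γ := by positivity
  by_contra! hpos
  set Φ : EuclideanSpace ℝ (Fin n) × EuclideanSpace ℝ (Fin n) → ℝ := fun w =>
    (1 - κ) * (u w.1 + N * R ^ γ) - (u w.2 + N * R ^ γ) -
      coneQuad (A * R ^ γ) R (w.1 - w.2) - scaledJap σ (h * R ^ γ) R 0 w.1 with hΦ
  have hΦ0 : 0 < Φ (x₀, y₀) := by
    simp only [hΦ]
    linarith
  have hΦc : Continuous Φ := by
    have := hu.continuous
    have := continuous_coneQuad (n := n) (A * R ^ γ) R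
    have := (contDiff_scaledJap (σ := σ) (h * R ^ γ) R
      (0 : EuclideanSpace ℝ (Fin n))).continuous
    fun_prop
  have hupper : ∀ x y, Φ (x, y) ≤ R ^ γ * ((h / 2 + 2 * N) - h / 4 * jap σ (R⁻¹ • x) -
      h / 2 * (‖x - y‖ / R) ^ 2) := by
    intro x y
    have hx := (le_abs_self _).trans (hbound R hR 0 (by simpa using hR0.le) x)
    have hy := (neg_le_abs _).trans (hbound R hR 0 (by simpa using hR0.le) y)
    rw [sub_zero] at hx hy
    have hj := jap_le_of_sub (by linarith) hσ2.le (R⁻¹ • x) (R⁻¹ • y)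
    rw [← smul_sub, norm_inv_smul hR0] at hj
    have hg0 : 0 ≤ jap σ (R⁻¹ • x) := by linarith [one_le_jap (σ := σ) (by linarith) (R⁻¹ • x)]
    have hX : (1 - κ) * (u x + N * R ^ γ) ≤ R ^ γ * (h / 4 * jap σ (R⁻¹ • x) + 2 * N) := by
      calc _ ≤ (1 - κ) * (R ^ γ * (h / 4 * jap σ (R⁻¹ • x) + 2 * N)) := by
            gcongr
            linarith
        _ ≤ 1 * (R ^ γ * (h / 4 * jap σ (R⁻¹ • x) + 2 * N)) := by
            gcongr
            linarith
        _ = _ := one_mul _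
    have hY : -(u y + N * R ^ γ) ≤
        R ^ γ * (h / 2 * (jap σ (R⁻¹ • x) + 1 + (‖x - y‖ / R) ^ 2)) := by
      calc _ ≤ R ^ γ * (h / 4 * jap σ (R⁻¹ • y)) := by linarith
        _ ≤ R ^ γ * (h / 4 * (2 * jap σ (R⁻¹ • x) + 2 * (1 + (‖x - y‖ / R) ^ 2))) := by gcongr
        _ = _ := by ring
    have hC : R ^ γ * (h * (‖x - y‖ / R) ^ 2) ≤ coneQuad (A * R ^ γ) R (x - y) := by
      have : 0 ≤ A * R ^ γ * (‖x - y‖ / R) := by positivity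
      calc _ ≤ R ^ γ * (A * (‖x - y‖ / R) ^ 2) := by gcongr
        _ ≤ _ := by
          rw [coneQuad]
          linarith
    simp only [hΦ, scaledJap, sub_zero]
    linarith
  have hloc : ∀ x y, 0 < Φ (x, y) → jap σ (R⁻¹ • x) ≤ G ∧ ‖x - y‖ / R ≤ G := by
    intro x y hxy
    have h1 := (mul_pos_iff_of_pos_left hRγ).1 (hxy.trans_le (hupper x y))
    have hg := one_le_jap (σ := σ) (by linarith) (R⁻¹ • x)
    have hGh : h * G = 2 * h + 8 * N := by
      rw [hG]
      field_simp
    have hsq : 0 ≤ h / 2 * (‖x - y‖ / R) ^ 2 := by positivity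
    constructor
    · refine le_of_mul_le_mul_left ?_ hh
      linarith
    · have h2 : (‖x - y‖ / R) ≤ 1 + (‖x - y‖ / R) ^ 2 := by
        nlinarith [sq_nonneg (‖x - y‖ / R - 1)]
      refine le_of_mul_le_mul_left ?_ hh
      have : h * (‖x - y‖ / R) ≤ h * (1 + (‖x - y‖ / R) ^ 2) := by gcongr
      have := mul_le_mul_of_nonneg_left hg hh.le
      linarith
  obtain ⟨⟨x, y⟩, hmax⟩ : ∃ w, ∀ w', Φ w' ≤ Φ w := by
    refine hΦc.exists_forall_ge' (x₀, y₀) ?_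
    filter_upwards [(isCompact_closedBall
      (0 : EuclideanSpace ℝ (Fin n) × EuclideanSpace ℝ (Fin n)) (2 * (R * G))).compl_mem_cocompact]
      with w hw
    by_contra! hlt
    apply hw
    obtain ⟨h1, h2⟩ := hloc w.1 w.2 (hΦ0.trans hlt)
    have h3 := (norm_le_jap hσ1.le (R⁻¹ • w.1)).trans h1
    rw [norm_inv_smul hR0, div_le_iff₀ hR0] at h3
    rw [div_le_iff₀ hR0] at h2
    have h4 : ‖w.2‖ ≤ ‖w.1‖ + ‖w.1 - w.2‖ := by
      have := norm_sub_norm_le w.2 w.1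
      rw [norm_sub_rev] at this
      linarith
    have h5 : 0 ≤ R * G := by positivity
    rw [mem_closedBall_zero_iff, Prod.norm_def, max_le_iff]
    constructor <;> linarith
  have hΦxy : 0 < Φ (x, y) := hΦ0.trans_le (hmax _)
  obtain ⟨hxG, -⟩ := hloc x y hΦxy
  -- On the diagonal only `-κ (u + N R^γ)` and the weight remain. The shift by `N R^γ` makes the
  -- former at most a quarter of the weight, so the doubled function is negative there and the cone
  -- is smooth at the maximum.
  have hne : x - y ≠ 0 := by
    intro hxy
    rw [sub_eq_zero] at hxy
    subst hxy
    have hx := (neg_le_abs _).trans (hbound R hR 0 (by simpa using hR0.le) x)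
    rw [sub_zero] at hx
    have hg := one_le_jap (σ := σ) (by linarith) (R⁻¹ • x)
    simp only [hΦ, sub_self, scaledJap, coneQuad, norm_zero, sub_zero] at hΦxy
    have h1 : -(κ * (u x + N * R ^ γ)) ≤ R ^ γ * (h / 4 * jap σ (R⁻¹ • x)) := by
      calc _ = κ * -(u x + N * R ^ γ) := by ring
        _ ≤ κ * (R ^ γ * (h / 4 * jap σ (R⁻¹ • x))) := by
            gcongr
            linarith
        _ ≤ 1 * (R ^ γ * (h / 4 * jap σ (R⁻¹ • x))) := by gcongr
        _ = _ := one_mul _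
    have h2 : 0 < R ^ γ * (h / 4 * jap σ (R⁻¹ • x)) := by positivity
    simp at hΦxy
    linarith
  have hcone2 := contDiffOn_coneQuad (A * R ^ γ) R (x - y)
  have hdiff : DifferentiableAt ℝ (coneQuad (A * R ^ γ) R) (x - y) :=
    (hcone2.contDiffAt (ball_mem_nhds _ (norm_pos_iff.2 hne))).differentiableAt (by norm_num)
  set p := gradient (coneQuad (A * R ^ γ) R) (x - y) with hp_def
  have hp : HasGradientAt (coneQuad (A * R ^ γ) R) p (x - y) := hdiff.hasGradientAt
  set q : EuclideanSpace ℝ (Fin n) := (h * R ^ γ * R⁻¹) • japGrad σ (R⁻¹ • (x - 0)) with hq_def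
  have hdbl := hu.doubling hn hσ1 hσ hs1 hlam hLam hI (continuous_coneQuad (A * R ^ γ) R)
    (norm_pos_iff.2 hne) hcone2 hp (contDiff_scaledJap (σ := σ) (h * R ^ γ) R 0)
    (hasGradientAt_scaledJap _ _ _ _) hμ0
    (fun x' y' => by
      have := hmax (x', y')
      simp only [hΦ] at this
      linarith)
    (by positivity) hR0 (scaledJap_increment_le hσ1 hσ2 (by positivity) hR0 0 x)
  rw [← hq_def] at hdbl
  set b : ℝ := R ^ γ * R⁻¹ with hb
  have hb0 : 0 < b := by positivity
  have hpb : A * b ≤ ‖p‖ := by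
    have := le_norm_gradient_coneQuad (by positivity) hR0 hne hp
    rwa [mul_assoc] at this
  have hqb : ‖q‖ ≤ Q * b := by
    rw [hq_def, norm_smul, Real.norm_of_nonneg (by positivity), sub_zero]
    have h1 := norm_japGrad_le (by linarith) hσ2.le (R⁻¹ • x) (σ := σ)
    calc _ ≤ h * R ^ γ * R⁻¹ * (2 * G) := by
          gcongr
          linarith
      _ = _ := by rw [hQ, hb]; ring
  have hpq : θ * ‖p‖ ≤ ‖p + q‖ := by
    have h1 : ‖p‖ - ‖q‖ ≤ ‖p + q‖ := by
      have := norm_sub_le (p + q) q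
      rw [add_sub_cancel_right] at this
      linarith
    have h2 : ‖q‖ ≤ (1 - θ) * ‖p‖ := by
      calc ‖q‖ ≤ Q * b := hqb
        _ ≤ (1 - θ) * A * b := by gcongr
        _ = (1 - θ) * (A * b) := by ring
        _ ≤ _ := by gcongr
    linarith
  have hgain : (1 + d) * ‖p‖ ^ m ≤ (1 - κ) * ‖(1 - κ)⁻¹ • (p + q)‖ ^ m := by
    have hle : (1 - κ)⁻¹ * θ * ‖p‖ ≤ (1 - κ)⁻¹ * ‖p + q‖ := by
      rw [mul_assoc]
      gcongr
    rw [← hθd, norm_smul, Real.norm_of_nonneg (by positivity), mul_assoc,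
      ← Real.mul_rpow (by positivity) (norm_nonneg _)]
    exact mul_le_mul_of_nonneg_left (Real.rpow_le_rpow (by positivity) hle (by linarith)) hμ0.le
  -- The only use of the condition on `γ`; for `R ≥ 1` equality of exponents is enough.
  have hbm : R ^ (γ - 2 * s) ≤ b ^ m := by
    have : b ^ m = R ^ (m * (γ - 1)) := by
      rw [hb, ← div_eq_mul_inv, ← Real.rpow_sub_one hR0.ne', ← Real.rpow_mul hR0.le, mul_comm]
    rw [this]
    exact Real.rpow_le_rpow_of_exponent_le hR hγm
  have hpm : A * b ^ m ≤ ‖p‖ ^ m := by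
    calc A * b ^ m ≤ A ^ m * b ^ m := by
          gcongr
          simpa using Real.rpow_le_rpow_of_exponent_le hA1 hm.le
      _ = (A * b) ^ m := (Real.mul_rpow (by linarith) hb0.le).symm
      _ ≤ _ := by gcongr
  have hrhs : Lam * (6 * (h * R ^ γ) * (R ^ (-(2 * s)) * powMinMass n s σ)) =
      D * R ^ (γ - 2 * s) := by
    rw [hD, sub_eq_add_neg, Real.rpow_add hR0]
    ring
  rw [hrhs] at hdbl
  have h1 : D * R ^ (γ - 2 * s) ≤ D * b ^ m := by gcongr
  have h2 : d * (A * b ^ m) ≤ d * ‖p‖ ^ m := by gcongr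
  have h3 : D * b ^ m < d * A * b ^ m := by gcongr
  linarith

/-- A modulus of continuity at scale `R`, uniform in `R`. -/
lemma IsViscositySolution.exists_modulus (hn : 1 ≤ n) (hσ1 : 1 < σ)
    (hσ : σ < 2 * s) (hs1 : s < 1) (hlam : 0 < lam) (hLam : lam ≤ Lam) (hm : 1 < m)
    (hI : IsSymEllipticOperator s lam Lam I)
    (hu : IsViscositySolution s I (fun p => ‖p‖ ^ m) u)
    (hγ0 : 0 ≤ γ) (hγσ : γ < σ) (hγm : γ - 2 * s ≤ m * (γ - 1))
    (hgrowth : ∀ x, |u x| ≤ M * (1 + ‖x‖) ^ γ) {ε : ℝ} (hε : 0 < ε) :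
    ∃ A, 0 ≤ A ∧ ∀ R, 1 ≤ R → ∀ x y, ‖x‖ ≤ 2 * R →
      u x - u y ≤ R ^ γ * (ε + A * (‖x - y‖ / R + (‖x - y‖ / R) ^ 2)) := by
  -- The weight is at most 5 on `B_{2R}`, so it costs `ε / 4`; `κ` below is chosen so that the
  -- factor `1 - κ` costs at most `ε / 2`.
  set h := ε / 20 with hh_def
  have hh : 0 < h := by positivity
  obtain ⟨N, hN, hbound⟩ := exists_abs_le_scaled hγ0 hγσ hgrowth (by positivity : 0 < h / 4)
  set κ : ℝ := min (1 / 2) (ε / (4 * (h + N))) with hκ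
  have hκ0 : 0 < κ := lt_min (by norm_num) (by positivity)
  have hκ1 : κ < 1 := (min_le_left _ _).trans_lt (by norm_num)
  obtain ⟨A, hA, hcone⟩ := hu.exists_cone_bound hn hσ1 hσ hs1 hlam hLam hm hI hγm hh hN
    hκ0 hκ1 hbound
  refine ⟨A, hA, fun R hR x y hx => ?_⟩
  have hR0 : 0 < R := by linarith
  have hRγ : 0 < R ^ γ := by positivity
  have h1 := hcone R hR x y
  have h2 := (le_abs_self _).trans (hbound R hR 0 (by simpa using hR0.le) x)
  have h3 : jap σ (R⁻¹ • x) ≤ 5 := jap_inv_smul_le_five (by linarith) hR0 hx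
  simp only [coneQuad, scaledJap, sub_zero] at h1 h2
  have h5 : κ * (u x + N * R ^ γ) ≤ R ^ γ * (ε / 2) := by
    have h6 : κ * (h + N) ≤ ε / 4 := by
      have h7 : κ ≤ ε / (4 * (h + N)) := min_le_right _ _
      rw [le_div_iff₀ (by positivity)] at h7
      linarith
    calc κ * (u x + N * R ^ γ) ≤ κ * (R ^ γ * (h / 4 * 5 + 2 * N)) := by
          gcongr
          have : R ^ γ * (h / 4 * jap σ (R⁻¹ • x)) ≤ R ^ γ * (h / 4 * 5) := by gcongr
          linarith
      _ ≤ κ * (R ^ γ * (2 * (h + N))) := by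
          gcongr
          linarith
      _ = R ^ γ * (2 * (κ * (h + N))) := by ring
      _ ≤ _ := by
          gcongr
          linarith
  have h6 : h * R ^ γ * jap σ (R⁻¹ • x) ≤ h * R ^ γ * 5 := by gcongr
  have h7 : h * R ^ γ * 5 = R ^ γ * (ε / 4) := by
    rw [hh_def]
    ring
  have h8 : 0 < R ^ γ * ε := by positivity
  linarith

/-- Below the critical exponent the oscillation on large balls is negligible. -/
lemma IsViscositySolution.exists_oscillation_le (hn : 1 ≤ n) (hσ1 : 1 < σ)
    (hσ : σ < 2 * s) (hs1 : s < 1) (hlam : 0 < lam) (hLam : lam ≤ Lam) (hm : 1 < m)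
    (hI : IsSymEllipticOperator s lam Lam I)
    (hu : IsViscositySolution s I (fun p => ‖p‖ ^ m) u)
    (hγ0 : 0 ≤ γ) (hγσ : γ < σ) (hγm : γ - 2 * s < m * (γ - 1))
    (hgrowth : ∀ x, |u x| ≤ M * (1 + ‖x‖) ^ γ) {ε : ℝ} (hε : 0 < ε) :
    ∃ R₀, 1 ≤ R₀ ∧ ∀ R, R₀ ≤ R → ∀ x y, ‖x‖ ≤ R → ‖y‖ ≤ R → u x - u y ≤ ε * R ^ γ := by
  have hσ2 : σ < 2 := by linarith
  have hm0 : 0 < m := by linarith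
  obtain ⟨A, hA, hmod⟩ := hu.exists_modulus hn hσ1 hσ hs1 hlam hLam hm hI hγ0 hγσ hγm.le
    hgrowth (by positivity : 0 < ε / 4)
  set h := ε / 20 with hh_def
  have hh : 0 < h := by positivity
  obtain ⟨N, hN, hbound⟩ := exists_abs_le_scaled hγ0 hγσ hgrowth (by positivity : 0 < h / 2)
  -- Comparing the maximum with the value at `y` gives `(h / 2) jap ≤ 2 N + 3 h / 2` at a contact
  -- point.
  set G : ℝ := 4 * N / h + 3 with hG
  have hG0 : 0 < G := by positivity
  set δ : ℝ := min 1 (ε / (8 * (A + 1))) with hδ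
  have hδ0 : 0 < δ := lt_min one_pos (by positivity)
  have hδ1 : δ ≤ 1 := min_le_left _ _
  have hδA : A * (δ + δ ^ 2) ≤ ε / 4 := by
    have h1 : δ ≤ ε / (8 * (A + 1)) := min_le_right _ _
    rw [le_div_iff₀ (by positivity)] at h1
    have h2 : A * (δ + δ ^ 2) ≤ A * (2 * δ) := by
      gcongr
      nlinarith
    linarith
  set D : ℝ := Lam * (6 * h * powMinMass n s σ) with hD
  set c : ℝ := (h * (δ / G)) ^ m with hc
  have hc0 : 0 < c := by positivity
  have hexp : 0 < m * (γ - 1) - (γ - 2 * s) := by linarith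
  -- Strict supercriticality is needed here: `δ` and `c` are already fixed, and `R` must beat `D /
  -- c`.
  obtain ⟨R₁, hR₁⟩ := eventually_atTop.1
    ((tendsto_rpow_atTop hexp).eventually (eventually_gt_atTop (D / c)))
  refine ⟨max 1 R₁, le_max_left _ _, fun R hR x y hx hy => ?_⟩
  have hR1 : 1 ≤ R := (le_max_left _ _).trans hR
  have hlarge := hR₁ R ((le_max_right _ _).trans hR)
  have hR0 : 0 < R := by linarith
  have hRγ : 0 < R ^ γ := by positivity
  set ψ : EuclideanSpace ℝ (Fin n) → ℝ := scaledJap σ (h * R ^ γ) R y with hψ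
  have hψy : ψ y = h * R ^ γ := by simp [hψ, scaledJap, jap]
  have huy := (neg_le_abs _).trans (hbound R hR1 y hy y)
  rw [sub_self, smul_zero, show jap σ (0 : EuclideanSpace ℝ (Fin n)) = 1 by simp [jap]] at huy
  have hGh : h * G = 4 * N + 3 * h := by
    rw [hG]
    field_simp
  have hloc : ∀ w, u y - ψ y ≤ u w - ψ w → jap σ (R⁻¹ • (w - y)) ≤ G := by
    intro w hw
    have huw := (le_abs_self _).trans (hbound R hR1 y hy w)
    rw [hψy] at hw
    simp only [hψ, scaledJap] at hw
    have h1 : R ^ γ * (h / 2 * jap σ (R⁻¹ • (w - y))) ≤ R ^ γ * (h / 2 * G) := by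
      have e : R ^ γ * (h / 2 * G) = R ^ γ * (2 * N + 3 / 2 * h) := by
        congr 1
        linarith
      rw [e]
      linarith
    exact le_of_mul_le_mul_left (le_of_mul_le_mul_left h1 hRγ) (by positivity)
  have hψ2 : ContDiff ℝ 2 ψ := contDiff_scaledJap _ _ _
  obtain ⟨w, hw⟩ : ∃ w, ∀ w', u w' - ψ w' ≤ u w - ψ w := by
    refine (hu.continuous.sub hψ2.continuous).exists_forall_ge' y ?_
    filter_upwards [(isCompact_closedBall y (R * G)).compl_mem_cocompact] with w hw
    by_contra! hlt
    apply hw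
    have h1 := (norm_le_jap hσ1.le _).trans (hloc w hlt.le)
    rw [norm_inv_smul hR0, div_le_iff₀ hR0] at h1
    rw [mem_closedBall_iff_norm]
    linarith
  have hwG := hloc w (hw y)
  have hgrad := hu.1.norm_gradient_rpow_le hn hσ1 hσ hs1 hlam hLam hI hψ2
    (hasGradientAt_scaledJap _ _ _ w) hw (by positivity) hR0
    (scaledJap_increment_le hσ1 hσ2 (by positivity) hR0 y w)
  set Z := R⁻¹ • (w - y) with hZ
  -- Otherwise the gradient of `ψ` at the contact point is at least `h (δ / G) R^(γ-1)`, whose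
  -- `m`-th power exceeds the bound `D R^(γ-2s)`.
  have hZδ : ‖Z‖ ≤ δ := by
    by_contra! hlt
    have h1 : h * (δ / G) * (R ^ γ * R⁻¹) ≤ ‖(h * R ^ γ * R⁻¹) • japGrad σ Z‖ := by
      rw [norm_smul, Real.norm_of_nonneg (by positivity)]
      have h2 : δ / G ≤ ‖japGrad σ Z‖ := by
        refine le_trans ?_ (norm_div_jap_le_norm_japGrad hσ1.le Z)
        have := one_le_jap (σ := σ) (by linarith) Z
        gcongr
      calc _ = h * R ^ γ * R⁻¹ * (δ / G) := by ring
        _ ≤ _ := by gcongr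
    have h2 := Real.rpow_le_rpow (by positivity) h1 hm0.le
    rw [Real.mul_rpow (by positivity) (by positivity), ← hc, ← div_eq_mul_inv,
      ← Real.rpow_sub_one hR0.ne', ← Real.rpow_mul hR0.le] at h2
    have h3 : Lam * (6 * (h * R ^ γ) * (R ^ (-(2 * s)) * powMinMass n s σ)) =
        D * R ^ (γ - 2 * s) := by
      rw [hD, sub_eq_add_neg, Real.rpow_add hR0]
      ring
    rw [h3, ← div_eq_mul_inv] at hgrad
    have h4 : R ^ ((γ - 1) * m) = R ^ (m * (γ - 1) - (γ - 2 * s)) * R ^ (γ - 2 * s) := by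
      rw [← Real.rpow_add hR0]
      congr 1
      ring
    have h5 : 0 < R ^ (γ - 2 * s) := by positivity
    rw [div_lt_iff₀ hc0] at hlarge
    rw [h4] at h2
    have h6 := mul_lt_mul_of_pos_right hlarge h5
    have h7 := h2.trans hgrad
    linarith
  have ht : ‖w - y‖ / R ≤ δ := by rwa [← norm_inv_smul hR0]
  have hwR : ‖w‖ ≤ 2 * R := by
    have h1 : ‖w - y‖ ≤ R := by
      rw [div_le_iff₀ hR0] at ht
      nlinarith
    have h2 := norm_add_le (w - y) y
    rw [sub_add_cancel] at h2
    linarith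
  -- In `u x - u y ≤ (u w - u y) + ψ x - ψ w`, the modulus bounds the first term by `(ε / 2) R^γ`,
  -- the small height of the weight bounds `ψ x` by `(ε / 4) R^γ`, and `ψ w ≥ 0`.
  have h1 := hmod R hR1 w y hwR
  have h2 : A * (‖w - y‖ / R + (‖w - y‖ / R) ^ 2) ≤ ε / 4 := by
    refine le_trans ?_ hδA
    gcongr
  have h3 : u w - u y ≤ R ^ γ * (ε / 4 + ε / 4) := h1.trans (by gcongr)
  have h4 : ψ x ≤ R ^ γ * (ε / 4) := by
    have h5 : jap σ (R⁻¹ • (x - y)) ≤ 5 :=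
      jap_inv_smul_le_five hσ2.le hR0 (by linarith [norm_sub_le x y])
    calc ψ x ≤ h * R ^ γ * 5 := by
          simp only [hψ, scaledJap]
          gcongr
      _ = _ := by
          rw [hh_def]
          ring
  have h5 : 0 ≤ ψ w := by
    have := one_le_jap (σ := σ) (by linarith) (R⁻¹ • (w - y))
    simp only [hψ, scaledJap]
    positivity
  have h6 := hw x
  have h7 : 0 < R ^ γ * ε := by positivity
  linarith

end

end NonlocalHJ

end

/-! ### Conclusion -/

theorem mainTheorem5 (n : ℕ) (hn : 1 ≤ n) (s lam Lam m γ M : ℝ)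
    (hs : 1 / 2 < s) (hs1 : s < 1) (hlam : 0 < lam) (hLam : lam ≤ Lam) (hm : 1 < m)
    (I : (EuclideanSpace ℝ (Fin n) → ℝ) → EuclideanSpace ℝ (Fin n) → ℝ)
    (hI : NonlocalHJ.IsSymEllipticOperator s lam Lam I)
    (u : EuclideanSpace ℝ (Fin n) → ℝ) (hu0 : u ≠ 0)
    (hu : NonlocalHJ.IsViscositySolution s I (fun p => ‖p‖ ^ m) u)
    (hγ : γ < 2 * s)
    (hgrowth : ∀ x : EuclideanSpace ℝ (Fin n), |u x| ≤ M * (1 + ‖x‖) ^ γ)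
    (hlimsup : 0 < Filter.limsup (fun x : EuclideanSpace ℝ (Fin n) => |u x| / ‖x‖ ^ γ)
      (Bornology.cobounded (EuclideanSpace ℝ (Fin n)))) :
    γ ≤ max 0 ((m - 2 * s) / (m - 1)) := by
  by_contra! hlt
  obtain ⟨hγ0, hγm⟩ := max_lt_iff.1 hlt
  rw [div_lt_iff₀ (by linarith)] at hγm
  obtain ⟨σ, hσ1, hσ⟩ := exists_between (max_lt (by linarith : (1 : ℝ) < 2 * s) hγ)
  have hσ1' := max_lt_iff.1 hσ1
  -- Makes the cobounded filter nontrivial, so that a limit determines the limsup.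
  have : Nontrivial (EuclideanSpace ℝ (Fin n)) := by
    apply Module.nontrivial_of_finrank_pos (R := ℝ)
    rw [finrank_euclideanSpace, Fintype.card_fin]
    omega
  have hnorm : Filter.Tendsto (fun x : EuclideanSpace ℝ (Fin n) => ‖x‖)
      (Bornology.cobounded _) Filter.atTop := tendsto_norm_cobounded_atTop
  have hlim : Filter.Tendsto (fun x : EuclideanSpace ℝ (Fin n) => |u x| / ‖x‖ ^ γ)
      (Bornology.cobounded _) (nhds 0) := by
    rw [Metric.tendsto_nhds]
    intro ε hε
    obtain ⟨R₀, hR₀, hosc⟩ := hu.exists_oscillation_le hn hσ1'.1 hσ hs1 hlam hLam hm hI hγ0.le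
      hσ1'.2 (by linarith) hgrowth (by positivity : 0 < ε / 4)
    -- Since `γ > 0`, the constant `|u 0|` is also negligible against `‖x‖^γ`.
    filter_upwards [hnorm.eventually_ge_atTop R₀,
      hnorm.eventually (((tendsto_rpow_atTop hγ0).eventually
        (Filter.eventually_gt_atTop (|u 0| / (ε / 4)))))] with x hx hx0
    have hpos : 0 < ‖x‖ := by linarith
    have hpow : 0 < ‖x‖ ^ γ := by positivity
    have h1 := hosc ‖x‖ hx x 0 le_rfl (by simp)
    have h2 := hosc ‖x‖ hx 0 x (by simp) le_rfl
    rw [div_lt_iff₀ (by positivity)] at hx0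
    rw [Real.dist_eq, sub_zero, abs_of_nonneg (by positivity), div_lt_iff₀ hpow]
    have h3 : |u x| ≤ |u 0| + ε / 4 * ‖x‖ ^ γ := by
      rw [abs_le]
      constructor <;> linarith [le_abs_self (u 0), neg_abs_le (u 0)]
    have h4 : 0 < ε * ‖x‖ ^ γ := by positivity
    linarith
  exact hlimsup.ne' hlim.limsup_eq
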